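/- **Setting.** A *vertex operator superalgebra* $(V,Y,\mathbf 1,\omega)$ over $\mathbb C$ is a $\mathbb Z_2$-graded vector space $V=V^0\oplus V^1$ (sign $|\cdot|$) with an even linear map $u\mapsto Y(u,x)$, $V\to \mathrm{Hom}(V,V((x)))$, and even vectors $\mathbf 1,\omega$, such that: $Y(\mathbf 1,x)=1$; $Y(v,x)\mathbf 1\in V[[x]]$ has constant term $v$; for homogeneous $u,v$ the Jacobi identity $$x_0^{-1}\delta\Big(\frac{x_1-x_2}{x_0}\Big)Y(u,x_1)Y(v,x_2)-(-1)^{|u||v|}x_0^{-1}\delta\Big(\frac{x_2-x_1}{-x_0}\Big)Y(v,x_2)Y(u,x_1)=x_2^{-1}\delta\Big(\frac{x_1-x_0}{x_2}\Big)Y(Y(u,x_0)v,x_2)$$ holds; $Y(\omega,x)=\sum_{n\in\mathbb Z}L(n)x^{-n-2}$ satisfies the Virasoro relations with a central charge $c\in\mathbb C$; $V$ is the direct sum of the eigenspaces of $L(0)$ with eigenvalues in $\frac12\mathbb Z$, which are finite-dimensional and vanish for sufficiently small eigenvalue; and $Y(L(-1)v,x)=\frac{d}{dx}Y(v,x)$.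 An *$N=2$ superconformal vertex operator superalgebra* is in addition equipped with odd $\tau^+,\tau^-\in V$ and an even $\mu\in V$ such that, with $Y(\tau^\pm,x)=\sum_{r\in\mathbb Z+1/2}G^\pm(r)x^{-r-3/2}$ and $Y(\mu,x)=\sum_{n\in\mathbb Z}J(n)x^{-n-1}$, $V$ is the direct sum of eigenspaces of $J(0)$ with integral eigenvalues, whose residues modulo $2$ give the $\mathbb Z_2$-grading, and the $N=2$ Neveu–Schwarz relations hold for $m,n\in\mathbb Z$, $r,s\in\mathbb Z+\frac12$ (brackets are supercommutators): the Virasoro relations, $[J(m),J(n)]=\frac c3 m\,\delta_{m+n,0}$, $[L(m),J(n)]=-nJ(m+n)$, $[L(m),G^\pm(r)]=(\frac m2-r)G^\pm(m+r)$, $[J(m),G^\pm(r)]=\pm G^\pm(m+r)$, $[G^+(r),G^-(s)]=2L(r+s)+(r-s)J(r+s)+\frac c3(r^2-\frac14)\delta_{r+s,0}$, $[G^\pm(r),G^\pm(s)]=0$. Put $\tau_1=\frac1{\sqrt2}(\tau^++\tau^-)$, $\tau_2=\frac1{\sqrt{-1}\sqrt2}(\tau^+-\tau^-)$ and $Y(\tau_i,x)=\sum_{r\in\mathbb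 Z+1/2} G_i(r)x^{-r-3/2}$. For anticommuting odd variables $\varphi_1,\varphi_2$, and $E[\varphi_1,\varphi_2]$ the tensor product of the exterior algebra on $\varphi_1,\varphi_2$ with $E$, the *vertex operator map with odd variables* $V\otimes V\to V((x))[\varphi_1,\varphi_2]$ is $$Y(u,(x,\varphi_1,\varphi_2))v=Y(u,x)v+\varphi_1Y(G_1(-\tfrac12)u,x)v+\varphi_2Y(G_2(-\tfrac12)u,x)v+\varphi_1\varphi_2Y(G_2(-\tfrac12)G_1(-\tfrac12)u,x)v .$$ Odd variables anticommute with odd operators on $V$; $Y(\cdot,(x,\varphi_1,\varphi_2))$ is extended to $V[\varphi_1,\dots]$ linearly over the exterior algebra acting from the left; the same formula defines $Y(u,(x,\theta_1,\theta_2))$ for other odd elements $\theta_1,\theta_2$ of an exterior algebra. $\frac{\partial}{\partial\varphi_i}$ is the left odd derivative. $\delta(z)=\sum_{n\in\mathbb Z}z^n$, where $n$-th powers of $y-z+s$ are expanded in nonnegative powers of $z$ and of the nilpotent element $s$. **Proposition.** For every $N=2$ superconformal vertex operator superalgebra $V$: 1. (Vacuum property) $Y(\mathbf 1,(x,\varphi_1,\varphi_2))=1$.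 2. (Creation property) For $v\in V$, $Y(v,(x,\varphi_1,\varphi_2))\mathbf 1\in V[[x]][\varphi_1,\varphi_2]$, and its value at $(x,\varphi_1,\varphi_2)=(0,0,0)$ is $v$. 3. (Jacobi identity) For $u,v\in V$ each even or odd, applied to any vector of $V$, all products below are well defined (each coefficient is a finite sum), and, with four odd variables $\varphi_1,\varphi_2,\psi_1,\psi_2$, $$\begin{aligned}&x_0^{-1}\delta\Big(\frac{x_1-x_2-\varphi_1\psi_1-\varphi_2\psi_2}{x_0}\Big)Y(u,(x_1,\varphi_1,\varphi_2))Y(v,(x_2,\psi_1,\psi_2))\\&\quad-(-1)^{|u||v|}x_0^{-1}\delta\Big(\frac{x_2-x_1+\varphi_1\psi_1+\varphi_2\psi_2}{-x_0}\Big)Y(v,(x_2,\psi_1,\psi_2))Y(u,(x_1,\varphi_1,\varphi_2))\\&=x_2^{-1}\delta\Big(\frac{x_1-x_0-\varphi_1\psi_1-\varphi_2\psi_2}{x_2}\Big)Y\big(Y(u,(x_0,\varphi_1-\psi_1,\varphi_2-\psi_2))v,(x_2,\psi_1,\psi_2)\big).\end{aligned}$$ 4. ($G_i(-\frac12)$-derivative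 property) For $v\in V$, $i=1,2$: $Y(G_i(-\tfrac12)v,(x,\varphi_1,\varphi_2))=\big(\frac{\partial}{\partial\varphi_i}+\varphi_i\frac{\partial}{\partial x}\big)Y(v,(x,\varphi_1,\varphi_2))$. 5. ($L(-1)$-derivative property) For $v\in V$: $Y(L(-1)v,(x,\varphi_1,\varphi_2))=\frac{\partial}{\partial x}Y(v,(x,\varphi_1,\varphi_2))$. 6. (Skew-symmetry) For $u,v\in V$ each even or odd, $$Y(u,(x,\varphi_1,\varphi_2))v=(-1)^{|u||v|}e^{xL(-1)+\varphi_1G_1(-1/2)+\varphi_2G_2(-1/2)}\,Y(v,(-x,-\varphi_1,-\varphi_2))u ,$$ where every coefficient of the formal exponential applied to the series is a finite sum. -/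

import Mathlib

open scoped TensorProduct

noncomputable section

namespace N2VOSA

/-! ### Formal delta functions

A formal series in `x₀, x₁, x₂` (all integral powers, coefficients in `M`) is a function
`ℤ × ℤ × ℤ → M`; its value at `(a, b, c)` is the coefficient of `x₀ ^ a * x₁ ^ b * x₂ ^ c`. -/

/-- The coefficient of `y ^ p * z ^ q` in `(y - z + s) ^ n`, where `n` is an arbitrary integer and
the power is expanded in nonnegative integral powers of `z` and of `s`:
`(y - z + s) ^ n = ∑_{j, k ≥ 0} C(n, j + k) C(j + k, j) (-1) ^ j y ^ (n - j - k) z ^ j s ^ k`. -/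
def powCoeff {A : Type*} [Ring A] (s : A) (n p q : ℤ) : A :=
  if 0 ≤ q ∧ p + q ≤ n then
    ((-1) ^ q.toNat * Ring.choose n (n - p).toNat * ((n - p).toNat.choose q.toNat : ℤ)) •
      s ^ (n - p - q).toNat
  else 0

/-- `x₀⁻¹ δ((x₁ - x₂ - s) / x₀) = ∑ₙ x₀ ^ (-n - 1) (x₁ - x₂ - s) ^ n`. -/
def deltaLeft {A : Type*} [Ring A] (s : A) : ℤ × ℤ × ℤ → A :=
  fun e => powCoeff (-s) (-e.1 - 1) e.2.1 e.2.2

/-- `x₀⁻¹ δ((x₂ - x₁ + s) / (-x₀)) = ∑ₙ (-1) ^ n x₀ ^ (-n - 1) (x₂ - x₁ + s) ^ n`. -/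
def deltaRight {A : Type*} [Ring A] (s : A) : ℤ × ℤ × ℤ → A :=
  fun e => (Int.negOnePow (-e.1 - 1) : ℤ) • powCoeff s (-e.1 - 1) e.2.2 e.2.1

/-- `x₂⁻¹ δ((x₁ - x₀ - s) / x₂) = ∑ₙ x₂ ^ (-n - 1) (x₁ - x₀ - s) ^ n`. -/
def deltaIter {A : Type*} [Ring A] (s : A) : ℤ × ℤ × ℤ → A :=
  fun e => powCoeff (-s) (-e.2.2 - 1) e.2.1 e.1

/-- The product of two formal series exists when every coefficient is a finite sum. -/
def ProductExists {A M : Type*} [Ring A] [AddCommGroup M] [Module A M]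
    (f : ℤ × ℤ × ℤ → A) (g : ℤ × ℤ × ℤ → M) : Prop :=
  ∀ e, {d | f d • g (e - d) ≠ 0}.Finite

/-- The (Cauchy) product of two formal series. -/
def seriesMul {A M : Type*} [Ring A] [AddCommGroup M] [Module A M]
    (f : ℤ × ℤ × ℤ → A) (g : ℤ × ℤ × ℤ → M) : ℤ × ℤ × ℤ → M :=
  fun e => ∑ᶠ d, f d • g (e - d)

/-! ### Vertex operator superalgebras -/

/-- A vertex operator superalgebra over `ℂ`. Here `VertexOperator ℂ V` is the space of linear maps
`V → V((x))`, `HVertexOperator.coeff A n` is the coefficient of `x ^ n` in `A`, and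
`VertexOperator.ncoeff A n` is the coefficient of `x ^ (-n - 1)`.

The sign grading is not required to be the reduction of the weights modulo `ℤ`; the
case where it is one is included. -/
structure VertexOperatorSuperalgebra (V : Type*) [AddCommGroup V] [Module ℂ V] where
  /-- the even subspace `V⁰ = sign 0` and the odd subspace `V¹ = sign 1` -/
  sign : ZMod 2 → Submodule ℂ V
  isCompl_sign : IsCompl (sign 0) (sign 1)
  /-- the vertex operator map `u ↦ Y(u, x)` -/
  Y : V →ₗ[ℂ] VertexOperator ℂ V
  /-- the vacuum vector -/
  vac : V
  /-- the conformal (Virasoro) vector -/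
  omega : V
  /-- the central charge -/
  c : ℂ
  vac_mem : vac ∈ sign 0
  omega_mem : omega ∈ sign 0
  /-- the vertex operator map is even -/
  Y_mem : ∀ i j, ∀ u ∈ sign i, ∀ v ∈ sign j, ∀ n,
    HVertexOperator.coeff (Y u) n v ∈ sign (i + j)
  /-- vacuum property: `Y(𝟏, x) = 1` -/
  vacuum : ∀ n, HVertexOperator.coeff (Y vac) n = if n = 0 then 1 else 0
  /-- creation property: `Y(v, x)𝟏 ∈ V[[x]]` has constant term `v` -/
  creation_neg : ∀ v, ∀ n < 0, HVertexOperator.coeff (Y v) n vac = 0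
  creation_zero : ∀ v, HVertexOperator.coeff (Y v) 0 vac = v
  /-- Jacobi identity:
  `x₀⁻¹δ((x₁-x₂)/x₀) Y(u,x₁)Y(v,x₂)w - (-1)^{|u||v|} x₀⁻¹δ((x₂-x₁)/(-x₀)) Y(v,x₂)Y(u,x₁)w`
  `= x₂⁻¹δ((x₁-x₀)/x₂) Y(Y(u,x₀)v,x₂)w` -/
  jacobi : ∀ i j, ∀ u ∈ sign i, ∀ v ∈ sign j, ∀ w : V, ∀ e,
    seriesMul (deltaLeft (0 : ℂ))
        (fun e => if e.1 = 0 then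
          HVertexOperator.coeff (Y u) e.2.1 (HVertexOperator.coeff (Y v) e.2.2 w) else 0) e
      - (-1 : ℂ) ^ (i * j).val •
        seriesMul (deltaRight (0 : ℂ))
          (fun e => if e.1 = 0 then
            HVertexOperator.coeff (Y v) e.2.2 (HVertexOperator.coeff (Y u) e.2.1 w) else 0) e
      = seriesMul (deltaIter (0 : ℂ))
          (fun e => if e.2.1 = 0 then
            HVertexOperator.coeff (Y (HVertexOperator.coeff (Y u) e.1 v)) e.2.2 w else 0) e
  /-- Virasoro relations for `L(n)`, where `Y(ω, x) = ∑ₙ L(n) x ^ (-n - 2)` -/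
  virasoro : ∀ m n : ℤ,
    VertexOperator.ncoeff (Y omega) (m + 1) * VertexOperator.ncoeff (Y omega) (n + 1)
      - VertexOperator.ncoeff (Y omega) (n + 1) * VertexOperator.ncoeff (Y omega) (m + 1)
      = ((m : ℂ) - n) • VertexOperator.ncoeff (Y omega) (m + n + 1)
        + (if m + n = 0 then c / 12 * ((m : ℂ) ^ 3 - m) else 0) • (1 : Module.End ℂ V)
  /-- `V` is the direct sum of the weight spaces `V_(k/2)`, `k ∈ ℤ`, the eigenspaces of `L(0)` -/
  weight_internal : DirectSum.IsInternal
    (fun k : ℤ => Module.End.eigenspace (VertexOperator.ncoeff (Y omega) 1) ((k : ℂ) / 2))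
  weight_finite : ∀ k : ℤ, FiniteDimensional ℂ
    (Module.End.eigenspace (VertexOperator.ncoeff (Y omega) 1) ((k : ℂ) / 2))
  weight_lower : ∃ N : ℤ, ∀ k < N,
    Module.End.eigenspace (VertexOperator.ncoeff (Y omega) 1) ((k : ℂ) / 2) = ⊥
  /-- `L(-1)`-derivative property: `Y(L(-1)v, x) = d/dx Y(v, x)` -/
  derivative : ∀ v n,
    HVertexOperator.coeff (Y (VertexOperator.ncoeff (Y omega) 0 v)) n
      = ((n : ℂ) + 1) • HVertexOperator.coeff (Y v) (n + 1)

namespace VertexOperatorSuperalgebra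

variable {V : Type*} [AddCommGroup V] [Module ℂ V] (S : VertexOperatorSuperalgebra V)

/-- The coefficient of `x ^ n` in `Y(u, x)`, as a linear function of `u`. -/
def coeffY (n : ℤ) : V →ₗ[ℂ] Module.End ℂ V :=
  LinearMap.proj n ∘ₗ HVertexOperator.coeff ∘ₗ S.Y

/-- The Virasoro operator `L(n)`. -/
def L (n : ℤ) : Module.End ℂ V := VertexOperator.ncoeff (S.Y S.omega) (n + 1)

/-- For a vector `t` of weight `3/2`, the operator `G(k + 1/2)` in
`Y(t, x) = ∑_{r ∈ ℤ + 1/2} G(r) x ^ (-r - 3/2)`. -/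
def G (t : V) (k : ℤ) : Module.End ℂ V := VertexOperator.ncoeff (S.Y t) (k + 1)

/-- For a vector `t` of weight `1`, the operator `J(n)` in `Y(t, x) = ∑ₙ J(n) x ^ (-n - 1)`. -/
def J (t : V) (n : ℤ) : Module.End ℂ V := VertexOperator.ncoeff (S.Y t) n

/-- The projections onto the even subspace and onto the odd subspace. -/
def projEven : Module.End ℂ V := Submodule.projection _ _ S.isCompl_sign

def projOdd : Module.End ℂ V := Submodule.projection _ _ S.isCompl_sign.symm

/-- The even and the odd component of an endomorphism of the superspace `V`. -/
def evenPart : Module.End ℂ V →ₗ[ℂ] Module.End ℂ V :=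
  LinearMap.mulLeftRight ℂ (S.projEven, S.projEven)
    + LinearMap.mulLeftRight ℂ (S.projOdd, S.projOdd)

def oddPart : Module.End ℂ V →ₗ[ℂ] Module.End ℂ V :=
  LinearMap.mulLeftRight ℂ (S.projEven, S.projOdd)
    + LinearMap.mulLeftRight ℂ (S.projOdd, S.projEven)

end VertexOperatorSuperalgebra

/-! ### `N = 2` superconformal vertex operator superalgebras -/

/-- An `N = 2` superconformal vertex operator superalgebra: a vertex operator superalgebra with odd
`τ⁺, τ⁻` and an even `μ` whose component operators satisfy the `N = 2` Neveu-Schwarz relations.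
The half-integers are written `r = k + 1/2`, `s = l + 1/2`; the Virasoro relations and
the relations not listed here are part of `VertexOperatorSuperalgebra`. -/
structure N2SuperconformalVOSA (V : Type*) [AddCommGroup V] [Module ℂ V] extends
    VertexOperatorSuperalgebra V where
  tauP : V
  tauM : V
  mu : V
  tauP_mem : tauP ∈ sign 1
  tauM_mem : tauM ∈ sign 1
  mu_mem : mu ∈ sign 0
  /-- `V` is the direct sum of the eigenspaces of `J(0)` with integral eigenvalues ... -/
  charge_internal : DirectSum.IsInternal
    (fun k : ℤ => Module.End.eigenspace (toVertexOperatorSuperalgebra.J mu 0) (k : ℂ))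
  /-- ... which modulo `2ℤ` give the sign grading -/
  charge_sign : ∀ i : ZMod 2, sign i = ⨆ (k : ℤ) (_ : (k : ZMod 2) = i),
    Module.End.eigenspace (toVertexOperatorSuperalgebra.J mu 0) (k : ℂ)
  /-- `[J(m), J(n)] = (c/3) m δ_{m+n,0}` -/
  J_J : ∀ m n : ℤ,
    toVertexOperatorSuperalgebra.J mu m * toVertexOperatorSuperalgebra.J mu n
      - toVertexOperatorSuperalgebra.J mu n * toVertexOperatorSuperalgebra.J mu m
      = (if m + n = 0 then c / 3 * (m : ℂ) else 0) • (1 : Module.End ℂ V)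
  /-- `[L(m), J(n)] = -n J(m+n)` -/
  L_J : ∀ m n : ℤ,
    toVertexOperatorSuperalgebra.L m * toVertexOperatorSuperalgebra.J mu n
      - toVertexOperatorSuperalgebra.J mu n * toVertexOperatorSuperalgebra.L m
      = (-(n : ℂ)) • toVertexOperatorSuperalgebra.J mu (m + n)
  /-- `[L(m), G±(r)] = (m/2 - r) G±(m+r)` -/
  L_GP : ∀ m k : ℤ,
    toVertexOperatorSuperalgebra.L m * toVertexOperatorSuperalgebra.G tauP k
      - toVertexOperatorSuperalgebra.G tauP k * toVertexOperatorSuperalgebra.L m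
      = ((m : ℂ) / 2 - ((k : ℂ) + 1 / 2)) • toVertexOperatorSuperalgebra.G tauP (m + k)
  L_GM : ∀ m k : ℤ,
    toVertexOperatorSuperalgebra.L m * toVertexOperatorSuperalgebra.G tauM k
      - toVertexOperatorSuperalgebra.G tauM k * toVertexOperatorSuperalgebra.L m
      = ((m : ℂ) / 2 - ((k : ℂ) + 1 / 2)) • toVertexOperatorSuperalgebra.G tauM (m + k)
  /-- `[J(m), G±(r)] = ± G±(m+r)` -/
  J_GP : ∀ m k : ℤ,
    toVertexOperatorSuperalgebra.J mu m * toVertexOperatorSuperalgebra.G tauP k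
      - toVertexOperatorSuperalgebra.G tauP k * toVertexOperatorSuperalgebra.J mu m
      = toVertexOperatorSuperalgebra.G tauP (m + k)
  J_GM : ∀ m k : ℤ,
    toVertexOperatorSuperalgebra.J mu m * toVertexOperatorSuperalgebra.G tauM k
      - toVertexOperatorSuperalgebra.G tauM k * toVertexOperatorSuperalgebra.J mu m
      = -toVertexOperatorSuperalgebra.G tauM (m + k)
  /-- `[G⁺(r), G⁻(s)] = 2 L(r+s) + (r-s) J(r+s) + (c/3) (r² - 1/4) δ_{r+s,0}`, an anticommutator -/
  GP_GM : ∀ k l : ℤ,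
    toVertexOperatorSuperalgebra.G tauP k * toVertexOperatorSuperalgebra.G tauM l
      + toVertexOperatorSuperalgebra.G tauM l * toVertexOperatorSuperalgebra.G tauP k
      = (2 : ℂ) • toVertexOperatorSuperalgebra.L (k + l + 1)
        + ((k : ℂ) - l) • toVertexOperatorSuperalgebra.J mu (k + l + 1)
        + (if k + l + 1 = 0 then c / 3 * (((k : ℂ) + 1 / 2) ^ 2 - 1 / 4) else 0)
          • (1 : Module.End ℂ V)
  /-- `[G±(r), G±(s)] = 0`, anticommutators -/
  GP_GP : ∀ k l : ℤ,
    toVertexOperatorSuperalgebra.G tauP k * toVertexOperatorSuperalgebra.G tauP l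
      + toVertexOperatorSuperalgebra.G tauP l * toVertexOperatorSuperalgebra.G tauP k = 0
  GM_GM : ∀ k l : ℤ,
    toVertexOperatorSuperalgebra.G tauM k * toVertexOperatorSuperalgebra.G tauM l
      + toVertexOperatorSuperalgebra.G tauM l * toVertexOperatorSuperalgebra.G tauM k = 0

/-! ### Odd formal variables

For a finite set `ι` of odd symbols, `E[φ_i : i ∈ ι]` is `Odd ι ⊗[ℂ] E`. -/

/-- The exterior algebra `ℂ[φ_i : i ∈ ι]` of the vector space spanned by the symbols `φ_i`. -/
abbrev Odd (ι : Type) : Type := ExteriorAlgebra ℂ (ι → ℂ)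

section OddVariables

variable {ι : Type}

/-- The odd variable `φ_i`. -/
def oddVar [DecidableEq ι] (i : ι) : Odd ι := ExteriorAlgebra.ι ℂ (Pi.single i (1 : ℂ))

/-- The parity involution of `ℂ[φ]`, the algebra automorphism with `φ_i ↦ -φ_i`. -/
def parityInv : Odd ι →ₗ[ℂ] Odd ι := CliffordAlgebra.involute.toLinearMap

/-- The (left) odd partial derivative `∂/∂φ_i` on `E[φ]`. -/
def oddDeriv (i : ι) (E : Type*) [AddCommGroup E] [Module ℂ E] :
    Odd ι ⊗[ℂ] E →ₗ[ℂ] Odd ι ⊗[ℂ] E :=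
  LinearMap.rTensor E
    (CliffordAlgebra.contractLeft (Q := (0 : QuadraticForm ℂ (ι → ℂ)))
      (LinearMap.proj i : (ι → ℂ) →ₗ[ℂ] ℂ))

/-- The evaluation `E[φ] → E` at `φ_i = 0` for all `i`. -/
def evalOddZero (E : Type*) [AddCommGroup E] [Module ℂ E] : Odd ι ⊗[ℂ] E →ₗ[ℂ] E :=
  (TensorProduct.lid ℂ E).toLinearMap ∘ₗ
    LinearMap.rTensor E (ExteriorAlgebra.algebraMapInv (R := ℂ) (M := ι → ℂ)).toLinearMap

/-- The derivative `∂/∂x` of a formal series in `x`, given by its coefficients. -/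
def dx {M : Type*} [AddCommGroup M] [Module ℂ M] (f : ℤ → M) : ℤ → M :=
  fun n => ((n : ℂ) + 1) • f (n + 1)

namespace VertexOperatorSuperalgebra

variable {V : Type*} [AddCommGroup V] [Module ℂ V] (S : VertexOperatorSuperalgebra V)

/-- The action of `(End V)[φ]` on `V[φ]`, in which odd variables anticommute with odd operators:
`(a ⊗ A)(b ⊗ w) = (-1) ^ (|A| |b|) (a b) ⊗ A w`. -/
def superAct : Odd ι ⊗[ℂ] Module.End ℂ V →ₗ[ℂ] Odd ι ⊗[ℂ] V →ₗ[ℂ] Odd ι ⊗[ℂ] V :=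
  TensorProduct.map₂ (LinearMap.mul ℂ (Odd ι)) S.evenPart
    + TensorProduct.map₂ ((LinearMap.mul ℂ (Odd ι)).compl₂ parityInv) S.oddPart

end VertexOperatorSuperalgebra

namespace N2SuperconformalVOSA

variable {V : Type*} [AddCommGroup V] [Module ℂ V] (S : N2SuperconformalVOSA V)

/-- `τ₁ = (τ⁺ + τ⁻) / √2` (index `0`) and `τ₂ = (τ⁺ - τ⁻) / √(-2)` (index `1`). -/
def tau : Fin 2 → V :=
  ![((Real.sqrt 2 : ℝ) : ℂ)⁻¹ • (S.tauP + S.tauM),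
    (Complex.I * ((Real.sqrt 2 : ℝ) : ℂ))⁻¹ • (S.tauP - S.tauM)]

/-- `G_1(-1/2)` (index `0`) and `G_2(-1/2)` (index `1`). -/
def Ghalf (i : Fin 2) : Module.End ℂ V := S.G (S.tau i) (-1)

/-- The vertex operator map with odd variables: the coefficient of `x ^ n` in
`Y(u, (x, θ₁, θ₂)) = Y(u, x) + θ₁ Y(G₁(-1/2)u, x) + θ₂ Y(G₂(-1/2)u, x)`
`  + θ₁ θ₂ Y(G₂(-1/2)G₁(-1/2)u, x) ∈ (End V)[[x, x⁻¹]][φ]`,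
linear in `u`. Here `θ₁, θ₂` are elements of `ℂ[φ]`; in the basic case they are odd variables. -/
def oddY (θ : Fin 2 → Odd ι) (n : ℤ) : V →ₗ[ℂ] Odd ι ⊗[ℂ] Module.End ℂ V :=
  TensorProduct.mk ℂ (Odd ι) (Module.End ℂ V) 1 ∘ₗ S.coeffY n
    + TensorProduct.mk ℂ (Odd ι) (Module.End ℂ V) (θ 0) ∘ₗ S.coeffY n ∘ₗ S.Ghalf 0
    + TensorProduct.mk ℂ (Odd ι) (Module.End ℂ V) (θ 1) ∘ₗ S.coeffY n ∘ₗ S.Ghalf 1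
    + TensorProduct.mk ℂ (Odd ι) (Module.End ℂ V) (θ 0 * θ 1) ∘ₗ
        S.coeffY n ∘ₗ S.Ghalf 1 ∘ₗ S.Ghalf 0

/-- The coefficient of `x ^ n` in `Y(u, (x, θ₁, θ₂))v`, for `v ∈ V`. -/
def oddYApply (θ : Fin 2 → Odd ι) (u v : V) (n : ℤ) : Odd ι ⊗[ℂ] V :=
  S.superAct (S.oddY θ n u) (1 ⊗ₜ[ℂ] v)

/-- The extension of `u ↦ Y(u, (x, θ₁, θ₂))` to `u ∈ V[φ]` which is linear over `ℂ[φ]` on the left: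
`Y(a ⊗ u, (x, θ₁, θ₂)) = a Y(u, (x, θ₁, θ₂))`. -/
def oddYExt (θ : Fin 2 → Odd ι) (n : ℤ) : Odd ι ⊗[ℂ] V →ₗ[ℂ] Odd ι ⊗[ℂ] Module.End ℂ V :=
  TensorProduct.lift
    ((Algebra.lsmul ℂ ℂ (Odd ι ⊗[ℂ] Module.End ℂ V)).toLinearMap.compl₂ (S.oddY θ n))

/-- `Y(u, (x₁, θ₁, θ₂)) Y(v, (x₂, η₁, η₂)) w` as a series in `x₀, x₁, x₂`. -/
def leftProduct (θ η : Fin 2 → Odd ι) (u v w : V) : ℤ × ℤ × ℤ → Odd ι ⊗[ℂ] V :=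
  fun e => if e.1 = 0 then S.superAct (S.oddY θ e.2.1 u) (S.oddYApply η v w e.2.2) else 0

/-- `Y(v, (x₂, η₁, η₂)) Y(u, (x₁, θ₁, θ₂)) w` as a series in `x₀, x₁, x₂`. -/
def rightProduct (θ η : Fin 2 → Odd ι) (u v w : V) : ℤ × ℤ × ℤ → Odd ι ⊗[ℂ] V :=
  fun e => if e.1 = 0 then S.superAct (S.oddY η e.2.2 v) (S.oddYApply θ u w e.2.1) else 0

/-- `Y(Y(u, (x₀, θ₁ - η₁, θ₂ - η₂)) v, (x₂, η₁, η₂)) w` as a series in `x₀, x₁, x₂`. -/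
def iterate (θ η : Fin 2 → Odd ι) (u v w : V) : ℤ × ℤ × ℤ → Odd ι ⊗[ℂ] V :=
  fun e => if e.2.1 = 0 then
    S.superAct (S.oddYExt η e.2.2 (S.oddYApply (θ - η) u v e.1)) (1 ⊗ₜ[ℂ] w) else 0

/-- The operator `x L(-1) + θ₁ G₁(-1/2) + θ₂ G₂(-1/2)` on series in `x` with coefficients in
`V[φ]`. -/
def exponent (θ : Fin 2 → Odd ι) : Module.End ℂ (ℤ → Odd ι ⊗[ℂ] V) :=
  LinearMap.pi fun n =>
    S.superAct (1 ⊗ₜ[ℂ] S.L (-1)) ∘ₗ LinearMap.proj (n - 1)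
      + S.superAct (θ 0 ⊗ₜ[ℂ] S.Ghalf 0 + θ 1 ⊗ₜ[ℂ] S.Ghalf 1) ∘ₗ LinearMap.proj n

end N2SuperconformalVOSA

end OddVariables

/-- The formal exponential `e^T f = ∑_m T^m f / m!` on series in `x` exists: every coefficient is
a finite sum. -/
def ExpExists {M : Type*} [AddCommGroup M] [Module ℂ M] (T : Module.End ℂ (ℤ → M)) (f : ℤ → M) :
    Prop :=
  ∀ n, {m : ℕ | (T ^ m) f n ≠ 0}.Finite

/-- The formal exponential `e^T f = ∑_m T^m f / m!` on series in `x`. -/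
def formalExp {M : Type*} [AddCommGroup M] [Module ℂ M] (T : Module.End ℂ (ℤ → M)) (f : ℤ → M) :
    ℤ → M :=
  fun n => ∑ᶠ m : ℕ, ((m.factorial : ℂ)⁻¹) • (T ^ m) f n

end N2VOSA

end

set_option linter.unusedSectionVars false

noncomputable section

/-! All six properties are reduced to `V[φ] = Odd ι ⊗ V`, on which the vertex operator map extends
with the Koszul sign rule (`oddMul`). Write `E_θ = e^(θ₁G₁(-1/2) + θ₂G₂(-1/2))` (`oddExp`); since
each `θᵢGᵢ(-1/2)` squares to zero, it is a product of two factors `1 + θᵢGᵢ(-1/2)`. The definition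
of the odd vertex operator says exactly that `Y(u, (x, θ)) = Y(E_θ u, x)` (`oddY_eq`).

Three facts about `E_θ` carry the proof. The commutator formula makes `θᵢGᵢ(-1/2)` a derivation of
the products `Y(U, x)W`, so `E_θ` is an automorphism of them (`oddExp_oddMul`). Since `Gᵢ(-1/2)² =
L(-1)` and `G₁(-1/2)`, `G₂(-1/2)` anticommute, `E_η E_(θ-η) = e^(sL(-1)) E_θ` with `s = θ₁η₁ + θ₂η₂`
and `s³ = 0` (`oddExp_oddExp_sub`). Finally `E_θ E_(-θ) = 1`.

Jacobi identity: the automorphism property and the second fact turn the iterate into `Y(Y(e^(sL(-1))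
E_θ u, x₀) E_η v, x₂)`, and the `L(-1)`-derivative property makes this the substitution `x₀ ↦ x₀ +
s` in the ordinary iterate of `E_θ u` and `E_η v` (`iterate_eq`). The other two products do not
involve `x₀`, and each delta function with shift `s` is the one without shift after the same
substitution. As `s` is nilpotent and commutes with the unshifted delta coefficients, the
substitution is a finite Taylor formula compatible with products (`translate_seriesMul`), so the
identity is the translate of the Jacobi identity on `V[φ]` (`jacobi_translate`).

Skew-symmetry: on `V[φ]` it reads `Y(U, x)v = ± e^(xL(-1)) Y(v, -x)U`. Take `U = E_θ u` and write
`Y(v, -x)E_θ u = E_θ Y(E_(-θ) v, -x)u`; the two exponentials commute and merge (`formalExp_add`).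
The remaining properties are comparisons of coefficients. -/

namespace N2VOSA

/-! ### Translation `x₀ ↦ x₀ + s` of formal series -/

section Series

variable {A M : Type*} [Ring A] [Algebra ℂ A] [AddCommGroup M] [Module ℂ M] [Module A M]
  [IsScalarTower ℂ A M]

/-- The partial derivative `∂/∂x₀` of a formal series in `x₀, x₁, x₂`. -/
def partialZero : (ℤ × ℤ × ℤ → M) →ₗ[ℂ] ℤ × ℤ × ℤ → M where
  toFun f e := ((e.1 : ℂ) + 1) • f (e + (1, 0, 0))
  map_add' f g := by ext e; simp
  map_smul' c f := by ext e; simp [smul_comm c]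

theorem partialZero_apply (f : ℤ × ℤ × ℤ → M) (e : ℤ × ℤ × ℤ) :
    partialZero f e = ((e.1 : ℂ) + 1) • f (e + (1, 0, 0)) := rfl

/-- The substitution `x₀ ↦ x₀ + s`, where `s ^ 3 = 0`. -/
def translate (s : A) (f : ℤ × ℤ × ℤ → M) : ℤ × ℤ × ℤ → M :=
  f + s • partialZero f + (1 / 2 : ℂ) • s ^ 2 • partialZero (partialZero f)

namespace ProductExists

variable {f f' : ℤ × ℤ × ℤ → A} {g g' : ℤ × ℤ × ℤ → M}

theorem partialZero_left (h : ProductExists f g) : ProductExists (partialZero f) g := by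
  intro e
  refine ((h (e + (1, 0, 0))).preimage
    (f := fun d : ℤ × ℤ × ℤ => d + (1, 0, 0)) (fun _ _ _ _ h => by simpa using h)).subset ?_
  intro d hd hd'
  refine hd ?_
  rw [add_sub_add_right_eq_sub] at hd'
  rw [partialZero_apply, smul_assoc, hd', smul_zero]

theorem partialZero_right (h : ProductExists f g) : ProductExists f (partialZero g) := by
  intro e
  refine (h (e + (1, 0, 0))).subset ?_
  intro d hd hd'
  refine hd ?_
  rw [add_sub_right_comm] at hd'
  rw [partialZero_apply, ← algebraMap_smul A, smul_smul, ← Algebra.commutes, mul_smul, hd',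
    smul_zero]

theorem add_left (h : ProductExists f g) (h' : ProductExists f' g) :
    ProductExists (f + f') g := by
  intro e
  refine ((h e).union (h' e)).subset fun d hd => ?_
  by_contra hc
  simp only [Set.mem_union, Set.mem_ofPred_eq, not_or, not_not] at hc
  exact hd (by simp [add_smul, hc.1, hc.2])

theorem add_right (h : ProductExists f g) (h' : ProductExists f g') :
    ProductExists f (g + g') := by
  intro e
  refine ((h e).union (h' e)).subset fun d hd => ?_
  by_contra hc
  simp only [Set.mem_union, Set.mem_ofPred_eq, not_or, not_not] at hc
  exact hd (by simp [hc.1, hc.2])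

theorem smul_left (h : ProductExists f g) (s : A) : ProductExists (s • f) g := by
  intro e
  refine (h e).subset fun d hd hd' => hd ?_
  simp [mul_smul, hd']

theorem smul_right (h : ProductExists f g) {s : A} (hs : ∀ d, Commute s (f d)) :
    ProductExists f (s • g) := by
  intro e
  refine (h e).subset fun d hd hd' => hd ?_
  rw [Pi.smul_apply, smul_smul, ← (hs d).eq, mul_smul, hd', smul_zero]

end ProductExists

variable {f f' : ℤ × ℤ × ℤ → A} {g g' : ℤ × ℤ × ℤ → M}

theorem seriesMul_add_left (h : ProductExists f g) (h' : ProductExists f' g) :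
    seriesMul (f + f') g = seriesMul f g + seriesMul f' g := by
  ext e
  simp only [seriesMul, Pi.add_apply, add_smul]
  exact finsum_add_distrib (h e) (h' e)

theorem seriesMul_add_right (h : ProductExists f g) (h' : ProductExists f g') :
    seriesMul f (g + g') = seriesMul f g + seriesMul f g' := by
  ext e
  simp only [seriesMul, Pi.add_apply, smul_add]
  exact finsum_add_distrib (h e) (h' e)

theorem seriesMul_smul_left (h : ProductExists f g) (s : A) :
    seriesMul (s • f) g = s • seriesMul f g := by
  ext e
  simp only [seriesMul, Pi.smul_apply, smul_eq_mul, mul_smul]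
  exact (smul_finsum' s (h e)).symm

theorem seriesMul_smul_right (h : ProductExists f g) {s : A} (hs : ∀ d, Commute s (f d)) :
    seriesMul f (s • g) = s • seriesMul f g := by
  rw [← seriesMul_smul_left h]
  ext e
  simp only [seriesMul, Pi.smul_apply, smul_eq_mul, smul_smul, (hs _).eq]

/-- The Leibniz rule, which makes the Taylor formula `translate` multiplicative. -/
theorem partialZero_seriesMul (h : ProductExists f g) :
    partialZero (seriesMul f g)
      = seriesMul (partialZero f) g + seriesMul f (partialZero g) := by
  ext e
  -- The exponent `e.1 + 1` of `x₀` is split into the share `d.1` of `f` and the remaining share of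
  -- `g`.
  have key : ∀ d : ℤ × ℤ × ℤ, ((e.1 : ℂ) + 1) • f d • g (e + (1, 0, 0) - d)
      = (d.1 : ℂ) • f d • g (e + (1, 0, 0) - d) + f d • partialZero g (e - d) := by
    intro d
    rw [partialZero_apply, ← add_sub_right_comm, ← algebraMap_smul A (_ : ℂ) (g _),
      smul_smul (f d), ← Algebra.commutes, mul_smul, algebraMap_smul, ← add_smul]
    congr 1
    push_cast [Prod.fst_sub]
    ring
  have hfin : {d : ℤ × ℤ × ℤ | (d.1 : ℂ) • f d • g (e + (1, 0, 0) - d) ≠ 0}.Finite :=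
    (h (e + (1, 0, 0))).subset fun d hd hd' => hd (by rw [hd', smul_zero])
  rw [partialZero_apply]
  simp only [seriesMul, Pi.add_apply]
  rw [smul_finsum' _ (h _), finsum_congr key,
    finsum_add_distrib hfin (h.partialZero_right e)]
  congr 1
  -- After `d ↦ d + (1, 0, 0)` the weight `d.1` becomes the factor `d.1 + 1` in the derivative of
  -- `f`.
  rw [← finsum_comp_equiv (Equiv.addRight ((1, 0, 0) : ℤ × ℤ × ℤ))]
  refine finsum_congr fun d => ?_
  rw [partialZero_apply, Equiv.coe_addRight, add_sub_add_right_eq_sub, smul_assoc]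
  simp

theorem commute_partialZero {s : A} (hs : ∀ d, Commute s (f d)) (d : ℤ × ℤ × ℤ) :
    Commute s (partialZero f d) :=
  (hs _).smul_right _

theorem half_smul_sq (s : A) (f : ℤ × ℤ × ℤ → M) :
    (1 / 2 : ℂ) • s ^ 2 • f = ((1 / 2 : ℂ) • s ^ 2) • f := by
  rw [smul_assoc]

theorem ProductExists.translate_right (h : ProductExists f g) {s : A}
    (hs : ∀ d, Commute s (f d)) : ProductExists f (translate s g) := by
  rw [translate, half_smul_sq]
  exact (h.add_right (h.partialZero_right.smul_right hs)).add_right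
    (h.partialZero_right.partialZero_right.smul_right fun d => ((hs d).pow_left 2).smul_left _)

theorem ProductExists.translate_left (h : ProductExists f g) (s : A) :
    ProductExists (translate s f) g := by
  rw [translate, half_smul_sq]
  exact (h.add_left (h.partialZero_left.smul_left s)).add_left
    (h.partialZero_left.partialZero_left.smul_left _)

theorem ProductExists.translate (h : ProductExists f g) {s : A} (hs : ∀ d, Commute s (f d)) :
    ProductExists (translate s f) (translate s g) :=
  (h.translate_right hs).translate_left s

theorem seriesMul_translate_right (h : ProductExists f g) {s : A} (hs : ∀ d, Commute s (f d)) :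
    seriesMul f (translate s g) = seriesMul f g + s • seriesMul f (partialZero g)
      + (1 / 2 : ℂ) • s ^ 2 • seriesMul f (partialZero (partialZero g)) := by
  have h1 := h.partialZero_right
  have h2 := h1.partialZero_right
  have hs2 : ∀ d, Commute ((1 / 2 : ℂ) • s ^ 2) (f d) :=
    fun d => ((hs d).pow_left 2).smul_left _
  rw [translate, half_smul_sq, seriesMul_add_right (h.add_right (h1.smul_right hs))
    (h2.smul_right hs2), seriesMul_add_right h (h1.smul_right hs), seriesMul_smul_right h1 hs,
    seriesMul_smul_right h2 hs2, half_smul_sq]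

theorem seriesMul_translate_left (h : ProductExists f g) (s : A) :
    seriesMul (translate s f) g = seriesMul f g + s • seriesMul (partialZero f) g
      + (1 / 2 : ℂ) • s ^ 2 • seriesMul (partialZero (partialZero f)) g := by
  have h1 := h.partialZero_left
  have h2 := h1.partialZero_left
  rw [translate, half_smul_sq, seriesMul_add_left (h.add_left (h1.smul_left s))
    (h2.smul_left _), seriesMul_add_left h (h1.smul_left s), seriesMul_smul_left h1,
    seriesMul_smul_left h2, half_smul_sq]

/-- The exponential `e^(s ∂)` of a derivation is multiplicative when `s` commutes with the first
factor; `s³ = 0` truncates it after the quadratic term and removes all cross terms of higher order.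
-/
theorem translate_seriesMul (h : ProductExists f g) {s : A} (hs : ∀ d, Commute s (f d))
    (hs3 : s ^ 3 = 0) :
    translate s (seriesMul f g) = seriesMul (translate s f) (translate s g) := by
  have hs1 := commute_partialZero hs
  have hs2 := commute_partialZero hs1
  have h1 := h.partialZero_left
  have h2 := h1.partialZero_left
  rw [seriesMul_translate_left (h.translate_right hs), seriesMul_translate_right h hs,
    seriesMul_translate_right h1 hs1, seriesMul_translate_right h2 hs2, translate,
    partialZero_seriesMul h, map_add, partialZero_seriesMul h1,
    partialZero_seriesMul h.partialZero_right]
  simp only [half_smul_sq]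
  -- The cross term `s²` is twice `t = s²/2`; with `t` abstracted, the comparison is additive.
  have hss : s * s = (1 / 2 : ℂ) • s ^ 2 + (1 / 2 : ℂ) • s ^ 2 := by
    rw [← add_smul, ← sq]; norm_num
  have hst : s * (1 / 2 : ℂ) • s ^ 2 = 0 := by
    rw [mul_smul_comm, ← pow_succ', hs3, smul_zero]
  have hts : (1 / 2 : ℂ) • s ^ 2 * s = 0 := by
    rw [smul_mul_assoc, ← pow_succ, hs3, smul_zero]
  have htt : (1 / 2 : ℂ) • s ^ 2 * (1 / 2 : ℂ) • s ^ 2 = 0 := by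
    rw [smul_mul_smul_comm, ← pow_add, pow_eq_zero_of_le (by norm_num) hs3, smul_zero]
  generalize (1 / 2 : ℂ) • s ^ 2 = t at *
  simp only [smul_add, smul_smul, hss, hst, hts, htt, zero_smul, add_smul]
  abel

end Series

/-! ### Delta functions with a nilpotent shift -/

section Delta

variable {A : Type*} [Ring A] [Algebra ℂ A]

theorem powCoeff_of_neg (s : A) (n p : ℤ) {q : ℤ} (hq : q < 0) : powCoeff s n p q = 0 :=
  if_neg fun h => by omega

theorem powCoeff_of_lt (s : A) {n p q : ℤ} (h : n < p + q) : powCoeff s n p q = 0 :=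
  if_neg fun h => by omega

theorem powCoeff_natCast (s : A) (n : ℤ) (q k : ℕ) : powCoeff s n (n - q - k) q
    = (((-1) ^ q * Ring.choose n (q + k) * ((q + k).choose q : ℤ) : ℤ) : ℂ) • s ^ k := by
  have h1 : (n - (n - q - k)).toNat = q + k := by omega
  have h2 : (n - (n - q - k) - (q : ℤ)).toNat = k := by omega
  rw [powCoeff, if_pos (by omega), h1, h2, Int.toNat_natCast, Int.cast_smul_eq_zsmul]

theorem powCoeff_zero (n p q : ℤ) : powCoeff (0 : A) n p q
    = ((if 0 ≤ q ∧ p + q = n then (-1) ^ q.toNat * Ring.choose n q.toNat else 0 : ℤ) : ℂ) • (1 : A) := by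
  rcases lt_or_ge q 0 with hq | hq
  · rw [powCoeff_of_neg _ _ _ hq, if_neg (by omega), Int.cast_zero, zero_smul]
  rcases lt_or_ge n (p + q) with h | h
  · rw [powCoeff_of_lt _ h, if_neg (by omega), Int.cast_zero, zero_smul]
  lift q to ℕ using hq
  obtain ⟨k, rfl⟩ : ∃ k : ℕ, p = n - q - k := ⟨(n - p - q).toNat, by omega⟩
  rw [powCoeff_natCast]
  rcases Nat.eq_zero_or_pos k with rfl | hk
  · simp
  · rw [if_neg (by omega), zero_pow (by omega), smul_zero, Int.cast_zero, zero_smul]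

theorem choose_add_one_mul (n : ℤ) (q : ℕ) :
    Ring.choose n (q + 1) * ((q : ℤ) + 1) = n * Ring.choose (n - 1) q := by
  have := Ring.choose_smul_choose n (n := q + 1) (k := 1) (by omega)
  simp only [Nat.choose_one_right, nsmul_eq_mul, Ring.choose_one_right, Nat.cast_one,
    add_tsub_cancel_right] at this
  rw [← this]; push_cast; ring

theorem choose_add_two_mul (n : ℤ) (q : ℕ) :
    Ring.choose n (q + 2) * (((q : ℤ) + 2) * (q + 1)) = n * (n - 1) * Ring.choose (n - 2) q := by
  have h1 := choose_add_one_mul n (q + 1)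
  have h2 := choose_add_one_mul (n - 1) q
  rw [sub_sub, one_add_one_eq_two] at h2
  rw [mul_assoc n, ← h2]
  push_cast at h1
  linear_combination ((q : ℤ) + 1) * h1

theorem natCast_choose_add_two (q : ℕ) :
    (((q + 2).choose q : ℕ) : ℂ) = 1 / 2 * (((q : ℂ) + 2) * (q + 1)) := by
  rw [Nat.choose_symm_add, Nat.cast_choose_two]
  push_cast
  ring

/-- Taylor expansion of `(y - z - s)^n` in `s`, with the derivatives written through lower powers of
`y - z`. The number `k` in the proof is the exponent of `s`, so only `k = 0, 1, 2` contribute. -/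
theorem powCoeff_neg_eq_exponent_shift {s : A} (hs3 : s ^ 3 = 0) (n p q : ℤ) :
    powCoeff (-s) n p q = powCoeff 0 n p q + s * ((-n : ℂ) • powCoeff 0 (n - 1) p q)
      + (1 / 2 : ℂ) • (s ^ 2 * ((-n : ℂ) • (-n + 1 : ℂ) • powCoeff 0 (n - 2) p q)) := by
  rcases lt_or_ge q 0 with hq | hq
  · simp [powCoeff_of_neg _ _ _ hq]
  rcases lt_or_ge n (p + q) with h | h
  · rw [powCoeff_of_lt _ h, powCoeff_of_lt _ h, powCoeff_of_lt _ (by omega),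
      powCoeff_of_lt _ (by omega)]
    simp
  lift q to ℕ using hq
  obtain ⟨k, rfl⟩ : ∃ k : ℕ, p = n - q - k := ⟨(n - p - q).toNat, by omega⟩
  rw [powCoeff_natCast, powCoeff_zero, powCoeff_zero, powCoeff_zero]
  match k with
  | 0 =>
    rw [if_pos (by omega), if_neg (by omega), if_neg (by omega)]
    simp
  | 1 =>
    rw [if_neg (by omega), if_pos (by omega), if_neg (by omega)]
    have h := congrArg (Int.cast (R := ℂ)) (choose_add_one_mul n q)
    simp only [Int.toNat_natCast,
      Int.cast_zero, zero_smul, smul_zero, mul_zero, add_zero, zero_add, pow_one,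
      mul_smul_comm, mul_one, smul_smul, Nat.choose_succ_self_right, smul_neg, ← neg_smul]
    congr 1
    push_cast at h ⊢
    linear_combination (-(-1 : ℂ) ^ q) * h
  | 2 =>
    rw [if_neg (by omega), if_neg (by omega), if_pos (by omega)]
    have h := congrArg (Int.cast (R := ℂ)) (choose_add_two_mul n q)
    simp only [Int.toNat_natCast,
      Int.cast_zero, zero_smul, smul_zero, mul_zero, add_zero, zero_add,
      mul_smul_comm, mul_one, smul_smul, neg_sq]
    congr 1
    push_cast [natCast_choose_add_two] at h ⊢
    linear_combination (1 / 2 * (-1 : ℂ) ^ q) * h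
  | k + 3 =>
    rw [if_neg (by push_cast; omega), if_neg (by push_cast; omega),
      if_neg (by push_cast; omega), neg_pow s,
      pow_eq_zero_of_le (Nat.le_add_left 3 k) hs3]
    simp

/-- The same expansion with derivatives taken in `z`, which is possible because `z` and `s` enter
only through `z + s`. This form is needed when `x₀` plays the role of `z`. -/
theorem powCoeff_neg_eq_coeff_shift {s : A} (hs3 : s ^ 3 = 0) (n p q : ℤ) :
    powCoeff (-s) n p q = powCoeff 0 n p q + s * ((q + 1 : ℂ) • powCoeff 0 n p (q + 1))
      + (1 / 2 : ℂ) • (s ^ 2 * ((q + 1 : ℂ) • (q + 2 : ℂ) • powCoeff 0 n p (q + 2))) := by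
  rcases lt_or_ge q 0 with hq | hq
  · rw [powCoeff_of_neg _ _ _ hq, powCoeff_of_neg _ _ _ hq]
    -- At `q = -1` and `q = -2` a shifted index can be nonnegative; the factor `q + 1` or `q + 2`
    -- then vanishes.
    obtain h | h | h : q = -1 ∨ q = -2 ∨ q + 2 < 0 := by omega
    · subst h; simp
    · subst h; simp [powCoeff_of_neg]
    · rw [powCoeff_of_neg _ _ _ h, powCoeff_of_neg _ _ _ (by omega)]; simp
  rcases lt_or_ge n (p + q) with h | h
  · rw [powCoeff_of_lt _ h, powCoeff_of_lt _ h, powCoeff_of_lt _ (by omega),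
      powCoeff_of_lt _ (by omega)]
    simp
  lift q to ℕ using hq
  obtain ⟨k, rfl⟩ : ∃ k : ℕ, p = n - q - k := ⟨(n - p - q).toNat, by omega⟩
  rw [powCoeff_natCast, powCoeff_zero, powCoeff_zero, powCoeff_zero]
  match k with
  | 0 =>
    rw [if_pos (by omega), if_neg (by omega), if_neg (by omega)]
    simp
  | 1 =>
    rw [if_neg (by omega), if_pos (by omega), if_neg (by omega)]
    have h2 : ((q : ℤ) + 1).toNat = q + 1 := by omega
    simp only [h2,
      Int.cast_zero, zero_smul, smul_zero, mul_zero, add_zero, zero_add, pow_one,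
      mul_smul_comm, mul_one, smul_smul, Nat.choose_succ_self_right, smul_neg, ← neg_smul]
    congr 1
    push_cast
    ring
  | 2 =>
    rw [if_neg (by omega), if_neg (by omega), if_pos (by omega)]
    have h2 : ((q : ℤ) + 2).toNat = q + 2 := by omega
    simp only [h2,
      Int.cast_zero, zero_smul, smul_zero, mul_zero, add_zero, zero_add,
      mul_smul_comm, mul_one, smul_smul, neg_sq]
    congr 1
    push_cast [natCast_choose_add_two]
    ring
  | k + 3 =>
    rw [if_neg (by push_cast; omega), if_neg (by push_cast; omega),
      if_neg (by push_cast; omega), neg_pow s,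
      pow_eq_zero_of_le (Nat.le_add_left 3 k) hs3]
    simp

/-- Here `x₀` occurs as `x₀ ^ (-n - 1)`, so `∂/∂x₀` shifts the exponent `n`, as in the expansion in
powers of `s`. -/
theorem deltaLeft_eq_translate {s : A} (hs3 : s ^ 3 = 0) :
    deltaLeft s = translate s (deltaLeft 0) := by
  ext ⟨a, b, c⟩
  simp only [deltaLeft, translate, Pi.add_apply, Pi.smul_apply, partialZero_apply,
    powCoeff_neg_eq_exponent_shift hs3, smul_eq_mul, neg_zero, Prod.mk_add_mk, add_zero]
  rw [show -(a + 1) - 1 = -a - 1 - 1 by ring, show -(a + 1 + 1) - 1 = -a - 1 - 2 by ring]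
  push_cast
  congr 5 <;> ring

theorem deltaRight_eq_translate {s : A} (hs3 : s ^ 3 = 0) :
    deltaRight s = translate s (deltaRight 0) := by
  have hs3' : (-s) ^ 3 = 0 := by rw [neg_pow, hs3, mul_zero]
  ext ⟨a, b, c⟩
  have h := powCoeff_neg_eq_exponent_shift hs3' (-a - 1) c b
  rw [neg_neg] at h
  simp only [deltaRight, translate, Pi.add_apply, Pi.smul_apply, partialZero_apply, h,
    smul_eq_mul, Prod.mk_add_mk, add_zero]
  -- The sign `(-1) ^ n` flips at each shift of `n`, which compensates for `+s` in place of `-s`.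
  have h1 (m : ℤ) : ((m - 1).negOnePow : ℤ) = -(m.negOnePow : ℤ) := by
    rw [Int.negOnePow_sub, Int.negOnePow_one, mul_neg, mul_one, Units.val_neg]
  rw [show -(a + 1) - 1 = -a - 1 - 1 by ring, show -(a + 1 + 1) - 1 = -a - 1 - 1 - 1 by ring,
    show -a - 1 - 2 = -a - 1 - 1 - 1 by ring, h1 (-a - 1 - 1),
    h1 (-a - 1), neg_neg]
  simp only [← Int.cast_smul_eq_zsmul ℂ, neg_sq, mul_smul_comm, neg_mul]
  push_cast
  module

/-- In this delta function `x₀` is the variable expanded in nonnegative powers and stands next to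
`s` as `x₀ + s`. -/
theorem deltaIter_eq_translate {s : A} (hs3 : s ^ 3 = 0) :
    deltaIter s = translate s (deltaIter 0) := by
  ext ⟨a, b, c⟩
  simp only [deltaIter, translate, Pi.add_apply, Pi.smul_apply, partialZero_apply,
    powCoeff_neg_eq_coeff_shift hs3, smul_eq_mul, neg_zero, Prod.mk_add_mk, add_zero]
  rw [show a + 1 + 1 = a + 2 by ring]
  push_cast
  congr 5
  ring

theorem powCoeff_zero_eq_algebraMap (n p q : ℤ) :
    powCoeff (0 : A) n p q = algebraMap ℂ A (powCoeff 0 n p q) := by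
  rw [powCoeff_zero, powCoeff_zero, Algebra.algebraMap_eq_smul_one, smul_eq_mul, mul_one]

theorem deltaLeft_zero (e : ℤ × ℤ × ℤ) :
    deltaLeft (0 : A) e = algebraMap ℂ A (deltaLeft 0 e) := by
  rw [deltaLeft, deltaLeft, neg_zero, neg_zero, powCoeff_zero_eq_algebraMap]

theorem deltaRight_zero (e : ℤ × ℤ × ℤ) :
    deltaRight (0 : A) e = algebraMap ℂ A (deltaRight 0 e) := by
  rw [deltaRight, deltaRight, powCoeff_zero_eq_algebraMap, map_zsmul]

theorem deltaIter_zero (e : ℤ × ℤ × ℤ) :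
    deltaIter (0 : A) e = algebraMap ℂ A (deltaIter 0 e) := by
  rw [deltaIter, deltaIter, neg_zero, neg_zero, powCoeff_zero_eq_algebraMap]

theorem powCoeff_zero_of_ne {n p q : ℤ} (h : ¬(0 ≤ q ∧ p + q = n)) :
    powCoeff (0 : A) n p q = 0 := by
  rw [powCoeff_zero, if_neg h, Int.cast_zero, zero_smul]

theorem deltaLeft_zero_of_ne {e : ℤ × ℤ × ℤ} (h : ¬(0 ≤ e.2.2 ∧ e.2.1 + e.2.2 = -e.1 - 1)) :
    deltaLeft (0 : A) e = 0 := by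
  rw [deltaLeft, neg_zero, powCoeff_zero_of_ne h]

theorem deltaRight_zero_of_ne {e : ℤ × ℤ × ℤ} (h : ¬(0 ≤ e.2.1 ∧ e.2.2 + e.2.1 = -e.1 - 1)) :
    deltaRight (0 : A) e = 0 := by
  rw [deltaRight, powCoeff_zero_of_ne h, smul_zero]

theorem deltaIter_zero_of_ne {e : ℤ × ℤ × ℤ} (h : ¬(0 ≤ e.1 ∧ e.2.1 + e.1 = -e.2.2 - 1)) :
    deltaIter (0 : A) e = 0 := by
  rw [deltaIter, neg_zero, powCoeff_zero_of_ne h]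

variable {M : Type*} [AddCommGroup M] [Module ℂ M] [Module A M] [IsScalarTower ℂ A M]
  {g : ℤ × ℤ × ℤ → M} {N : ℤ}

/-- The contributing exponents lie on a line parametrized by the power of `x₂` in the delta
function: the expansion bounds it below by `0`, truncation of `g` bounds it above. -/
theorem productExists_deltaLeft_zero (h0 : ∀ e, e.1 ≠ 0 → g e = 0)
    (hN : ∀ e, e.2.2 < N → g e = 0) : ProductExists (deltaLeft (0 : A)) g := by
  intro e
  refine ((Set.finite_Icc 0 (e.2.2 - N)).image fun q => (e.1, -e.1 - 1 - q, q)).subset ?_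
  intro d hd
  have h1 : (e - d).1 = 0 := by
    by_contra h; exact hd (by rw [h0 _ h, smul_zero])
  have h2 : N ≤ (e - d).2.2 := by
    by_contra h; exact hd (by rw [hN _ (not_le.1 h), smul_zero])
  have h3 : 0 ≤ d.2.2 ∧ d.2.1 + d.2.2 = -d.1 - 1 := by
    by_contra h; exact hd (by rw [deltaLeft_zero_of_ne h, zero_smul])
  simp only [Prod.fst_sub, Prod.snd_sub] at h1 h2
  exact ⟨d.2.2, ⟨h3.1, by omega⟩, Prod.ext (by dsimp; omega) (Prod.ext (by dsimp; omega) rfl)⟩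

theorem productExists_deltaRight_zero (h0 : ∀ e, e.1 ≠ 0 → g e = 0)
    (hN : ∀ e, e.2.1 < N → g e = 0) : ProductExists (deltaRight (0 : A)) g := by
  intro e
  refine ((Set.finite_Icc 0 (e.2.1 - N)).image fun q => (e.1, q, -e.1 - 1 - q)).subset ?_
  intro d hd
  have h1 : (e - d).1 = 0 := by
    by_contra h; exact hd (by rw [h0 _ h, smul_zero])
  have h2 : N ≤ (e - d).2.1 := by
    by_contra h; exact hd (by rw [hN _ (not_le.1 h), smul_zero])
  have h3 : 0 ≤ d.2.1 ∧ d.2.2 + d.2.1 = -d.1 - 1 := by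
    by_contra h; exact hd (by rw [deltaRight_zero_of_ne h, zero_smul])
  simp only [Prod.fst_sub, Prod.snd_sub] at h1 h2
  exact ⟨d.2.1, ⟨h3.1, by omega⟩, Prod.ext (by dsimp; omega) (Prod.ext rfl (by dsimp; omega))⟩

theorem productExists_deltaIter_zero (h0 : ∀ e, e.2.1 ≠ 0 → g e = 0)
    (hN : ∀ e, e.1 < N → g e = 0) : ProductExists (deltaIter (0 : A)) g := by
  intro e
  refine ((Set.finite_Icc 0 (e.1 - N)).image fun q => (q, e.2.1, -e.2.1 - 1 - q)).subset ?_
  intro d hd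
  have h1 : (e - d).2.1 = 0 := by
    by_contra h; exact hd (by rw [h0 _ h, smul_zero])
  have h2 : N ≤ (e - d).1 := by
    by_contra h; exact hd (by rw [hN _ (not_le.1 h), smul_zero])
  have h3 : 0 ≤ d.1 ∧ d.2.1 + d.1 = -d.2.2 - 1 := by
    by_contra h; exact hd (by rw [deltaIter_zero_of_ne h, zero_smul])
  simp only [Prod.fst_sub, Prod.snd_sub] at h1 h2
  exact ⟨d.1, ⟨h3.1, by omega⟩, Prod.ext rfl (Prod.ext (by dsimp; omega) (by dsimp; omega))⟩

/-- Transports products with scalar delta functions from `V` to `V[φ]` along the maps `v ↦ a ⊗ v`.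
Existence of the product is what lets `φ` pass through the sum. -/
theorem seriesMul_algebraMap_comp {V : Type*} [AddCommGroup V] [Module ℂ V]
    {f : ℤ × ℤ × ℤ → ℂ} {P : ℤ × ℤ × ℤ → V} (h : ProductExists f P) (φ : V →ₗ[ℂ] M) :
    seriesMul (fun d => algebraMap ℂ A (f d)) (fun e => φ (P e))
      = fun e => φ (seriesMul f P e) := by
  ext e
  simp only [seriesMul, algebraMap_smul, ← map_smul]
  exact (φ.toAddMonoidHom.map_finsum (h e)).symm

theorem finsum_eq_finsum_comp {α β : Type*} {f : β → M} {ψ : α → β} (hψ : ψ.Injective)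
    (h : ∀ b, b ∉ Set.range ψ → f b = 0) : ∑ᶠ b, f b = ∑ᶠ a, f (ψ a) := by
  rw [← finsum_mem_range hψ, ← finsum_mem_univ]
  refine finsum_mem_inter_support_eq' _ _ _ fun x hx => ?_
  simp only [Set.mem_univ, true_iff]
  by_contra h'
  exact hx (h x h')

/-- Component form of the Jacobi identity, used with its two companions to extract the commutator
formula and skew-symmetry. -/
theorem seriesMul_deltaLeft_zero (h0 : ∀ e, e.1 ≠ 0 → g e = 0) (a b c : ℤ) :
    seriesMul (deltaLeft (0 : ℂ)) g (a, b, c) = ∑ᶠ q : ℕ,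
      (((-1) ^ q * Ring.choose (-a - 1) q : ℤ) : ℂ) • g (0, b + a + 1 + q, c - q) := by
  rw [seriesMul, finsum_eq_finsum_comp (ψ := fun q : ℕ => (a, -a - 1 - q, (q : ℤ)))]
  · refine finsum_congr fun q => ?_
    rw [deltaLeft, neg_zero, powCoeff_zero, if_pos (by dsimp; omega)]
    simp only [Int.toNat_natCast, smul_eq_mul, mul_one, Prod.mk_sub_mk, sub_self]
    congr 4
    ring
  · intro q q' h
    simpa using h
  · rintro ⟨x, y, z⟩ h
    by_cases hx : x = a
    · rw [deltaLeft_zero_of_ne, zero_smul]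
      rintro ⟨h1, h2⟩
      dsimp only at h1 h2
      exact h ⟨z.toNat, by ext <;> dsimp <;> omega⟩
    · rw [h0 _ (by dsimp; omega), smul_zero]

theorem seriesMul_deltaRight_zero (h0 : ∀ e, e.1 ≠ 0 → g e = 0) (a b c : ℤ) :
    seriesMul (deltaRight (0 : ℂ)) g (a, b, c) = ∑ᶠ q : ℕ,
      (((-a - 1).negOnePow * ((-1) ^ q * Ring.choose (-a - 1) q) : ℤ) : ℂ)
        • g (0, b - q, c + a + 1 + q) := by
  rw [seriesMul, finsum_eq_finsum_comp (ψ := fun q : ℕ => (a, (q : ℤ), -a - 1 - q))]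
  · refine finsum_congr fun q => ?_
    rw [deltaRight, powCoeff_zero, if_pos (by dsimp; omega), ← Int.cast_smul_eq_zsmul ℂ]
    simp only [Int.toNat_natCast, smul_eq_mul, mul_one, Prod.mk_sub_mk, sub_self, ← Int.cast_mul]
    congr 4
    ring
  · intro q q' h
    simpa using h
  · rintro ⟨x, y, z⟩ h
    by_cases hx : x = a
    · rw [deltaRight_zero_of_ne, zero_smul]
      rintro ⟨h1, h2⟩
      dsimp only at h1 h2
      exact h ⟨y.toNat, by ext <;> dsimp <;> omega⟩
    · rw [h0 _ (by dsimp; omega), smul_zero]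

theorem seriesMul_deltaIter_zero (h0 : ∀ e, e.2.1 ≠ 0 → g e = 0) (a b c : ℤ) :
    seriesMul (deltaIter (0 : ℂ)) g (a, b, c) = ∑ᶠ q : ℕ,
      (((-1) ^ q * Ring.choose (b + q) q : ℤ) : ℂ) • g (a - q, 0, c + b + 1 + q) := by
  rw [seriesMul, finsum_eq_finsum_comp (ψ := fun q : ℕ => ((q : ℤ), b, -b - 1 - q))]
  · refine finsum_congr fun q => ?_
    rw [deltaIter, neg_zero, powCoeff_zero, if_pos (by dsimp; omega)]
    simp only [Int.toNat_natCast, smul_eq_mul, mul_one, Prod.mk_sub_mk, sub_self]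
    congr 4
    · ring
    · ring
  · intro q q' h
    simpa using h
  · rintro ⟨x, y, z⟩ h
    by_cases hx : y = b
    · rw [deltaIter_zero_of_ne, zero_smul]
      rintro ⟨h1, h2⟩
      dsimp only at h1 h2
      exact h ⟨x.toNat, by ext <;> dsimp <;> omega⟩
    · rw [h0 _ (by dsimp; omega), smul_zero]

end Delta

/-! ### Commutator formula and skew-symmetry on `V` -/

namespace VertexOperatorSuperalgebra

variable {V : Type*} [AddCommGroup V] [Module ℂ V] (S : VertexOperatorSuperalgebra V)

theorem coeffY_apply (n : ℤ) (u : V) : S.coeffY n u = HVertexOperator.coeff (S.Y u) n := rfl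

theorem exists_coeffY_eq_zero (u v : V) : ∃ N : ℤ, ∀ n < N, S.coeffY n u v = 0 :=
  ⟨_, fun n hn => VertexOperator.coeff_eq_zero_of_lt_order (S.Y u) n v hn⟩

theorem coeffY_mem {i j : ZMod 2} {u v : V} (hu : u ∈ S.sign i) (hv : v ∈ S.sign j) (n : ℤ) :
    S.coeffY n u v ∈ S.sign (i + j) :=
  S.Y_mem i j u hu v hv n

theorem coeffY_L (v : V) (n : ℤ) :
    S.coeffY n (S.L (-1) v) = ((n : ℂ) + 1) • S.coeffY (n + 1) v :=
  S.derivative v n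

theorem coeffY_L_pow (v : V) (m : ℕ) (n : ℕ) :
    S.coeffY n ((S.L (-1) ^ m) v) = (((n + m).factorial : ℂ) / (n.factorial : ℂ))
      • S.coeffY (n + m : ℕ) v := by
  induction m generalizing n with
  | zero => simp [Nat.factorial_ne_zero]
  | succ m ih =>
    have h := ih (n + 1)
    rw [pow_succ', Module.End.mul_apply, coeffY_L]
    push_cast at h
    rw [h, smul_smul, show n + 1 + m = n + (m + 1) by ring]
    rw [show ((n : ℤ) + 1 + m) = ((n + (m + 1) : ℕ) : ℤ) by push_cast; ring]
    congr 1
    rw [Nat.factorial_succ n]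
    push_cast
    have : (n.factorial : ℂ) ≠ 0 := by exact_mod_cast n.factorial_ne_zero
    have : (n : ℂ) + 1 ≠ 0 := by exact_mod_cast n.succ_ne_zero
    field_simp

/-- The coefficient form of `Y(v, x)𝟏 = e^(xL(-1)) v`: apply the creation property to `L(-1)^m v`
and move `L(-1)^m` into derivatives. -/
theorem coeffY_vac (v : V) (m : ℕ) :
    S.coeffY m v S.vac = ((m.factorial : ℂ)⁻¹) • (S.L (-1) ^ m) v := by
  have h := S.coeffY_L_pow v m 0
  have h0 := S.creation_zero ((S.L (-1) ^ m) v)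
  rw [← coeffY_apply] at h0
  have hm : (m.factorial : ℂ) ≠ 0 := by exact_mod_cast m.factorial_ne_zero
  simp only [Nat.cast_zero, zero_add, Nat.factorial_zero, Nat.cast_one, div_one] at h
  rw [← h0, h, LinearMap.smul_apply, smul_smul, inv_mul_cancel₀ hm, one_smul]

theorem coeffY_vac_of_neg (v : V) {n : ℤ} (hn : n < 0) : S.coeffY n v S.vac = 0 :=
  S.creation_neg v n hn

/-- The three products in the Jacobi identity, as series in `x₀, x₁, x₂`. -/
def leftSeries (u v w : V) : ℤ × ℤ × ℤ → V := fun e =>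
  if e.1 = 0 then S.coeffY e.2.1 u (S.coeffY e.2.2 v w) else 0

def rightSeries (u v w : V) : ℤ × ℤ × ℤ → V := fun e =>
  if e.1 = 0 then S.coeffY e.2.2 v (S.coeffY e.2.1 u w) else 0

def iterSeries (u v w : V) : ℤ × ℤ × ℤ → V := fun e =>
  if e.2.1 = 0 then S.coeffY e.2.2 (S.coeffY e.1 u v) w else 0

theorem leftSeries_of_ne (u v w : V) (e : ℤ × ℤ × ℤ) (he : e.1 ≠ 0) :
    S.leftSeries u v w e = 0 :=
  if_neg he

theorem rightSeries_of_ne (u v w : V) (e : ℤ × ℤ × ℤ) (he : e.1 ≠ 0) :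
    S.rightSeries u v w e = 0 :=
  if_neg he

theorem iterSeries_of_ne (u v w : V) (e : ℤ × ℤ × ℤ) (he : e.2.1 ≠ 0) :
    S.iterSeries u v w e = 0 :=
  if_neg he

theorem productExists_leftSeries (u v w : V) :
    ProductExists (deltaLeft (0 : ℂ)) (S.leftSeries u v w) := by
  obtain ⟨N, hN⟩ := S.exists_coeffY_eq_zero v w
  exact productExists_deltaLeft_zero (N := N) (fun e he => if_neg he)
    fun e he => by simp [leftSeries, hN _ he]

theorem productExists_rightSeries (u v w : V) :
    ProductExists (deltaRight (0 : ℂ)) (S.rightSeries u v w) := by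
  obtain ⟨N, hN⟩ := S.exists_coeffY_eq_zero u w
  exact productExists_deltaRight_zero (N := N) (fun e he => if_neg he)
    fun e he => by simp [rightSeries, hN _ he]

theorem productExists_iterSeries (u v w : V) :
    ProductExists (deltaIter (0 : ℂ)) (S.iterSeries u v w) := by
  obtain ⟨N, hN⟩ := S.exists_coeffY_eq_zero u v
  exact productExists_deltaIter_zero (N := N) (fun e he => if_neg he)
    fun e he => by simp [iterSeries, hN _ he]

theorem jacobi_series {i j : ZMod 2} {u v : V} (hu : u ∈ S.sign i) (hv : v ∈ S.sign j) (w : V) :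
    seriesMul (deltaLeft (0 : ℂ)) (S.leftSeries u v w)
      - (-1 : ℂ) ^ (i * j).val • seriesMul (deltaRight (0 : ℂ)) (S.rightSeries u v w)
      = seriesMul (deltaIter (0 : ℂ)) (S.iterSeries u v w) :=
  funext fun e => S.jacobi i j u hu v hv w e

/-- The commutator formula for the residue of a vertex operator. -/
theorem coeffY_neg_one_commutator {i j : ZMod 2} {t v : V} (ht : t ∈ S.sign i)
    (hv : v ∈ S.sign j) (w : V) (n : ℤ) :
    S.coeffY (-1) t (S.coeffY n v w) = S.coeffY n (S.coeffY (-1) t v) w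
      + (-1 : ℂ) ^ (i * j).val • S.coeffY n v (S.coeffY (-1) t w) := by
  -- Residues in `x₀` and `x₁`: the delta functions on the left have exponent `0`, so only `q = 0`
  -- remains; on the right `C(q - 1, q) = 0` for `q ≥ 1`.
  have h := congrFun (S.jacobi_series ht hv w) (-1, -1, n)
  rw [Pi.sub_apply, Pi.smul_apply, seriesMul_deltaLeft_zero (S.leftSeries_of_ne _ _ _),
    seriesMul_deltaRight_zero (S.rightSeries_of_ne _ _ _),
    seriesMul_deltaIter_zero (S.iterSeries_of_ne _ _ _),
    finsum_eq_single _ 0, finsum_eq_single _ 0, finsum_eq_single _ 0] at h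
  · simp only [leftSeries, rightSeries, iterSeries] at h
    rw [← sub_eq_iff_eq_add]
    simpa using h
  · intro q hq
    have : Ring.choose (-1 + (q : ℤ)) q = 0 := by
      rw [show -1 + (q : ℤ) = ((q - 1 : ℕ) : ℤ) by omega, Ring.choose_natCast,
        Nat.choose_eq_zero_of_lt (by omega), Nat.cast_zero]
    simp [this]
  · intro q hq
    simp [Ring.choose_zero_pos ℤ (Nat.pos_of_ne_zero hq)]
  · intro q hq
    simp [Ring.choose_zero_pos ℤ (Nat.pos_of_ne_zero hq)]

/-- Skew-symmetry of the vertex operator map. -/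
theorem coeffY_skew {i j : ZMod 2} {u v : V} (hu : u ∈ S.sign i)
    (hv : v ∈ S.sign j) (n : ℤ) :
    S.coeffY n u v = (-1 : ℂ) ^ (i * j).val • ∑ᶠ q : ℕ, ((q.factorial : ℂ)⁻¹) •
      (S.L (-1) ^ q) ((-1 : ℂ) ^ (n - q) • S.coeffY (n - q) v u) := by
  -- The roles of `u` and `v` are exchanged and the identity acts on the vacuum. At `x₂^(-1)` the
  -- first product dies because `Y(u, x₂)𝟏` has no negative powers; at `x₁^0` the second keeps only
  -- the constant term `v` of `Y(v, x₁)𝟏`; the iterate acts on `𝟏` through `e^(x₂L(-1))`.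
  have h := congrFun (S.jacobi_series hv hu S.vac) (n, 0, -1)
  rw [Pi.sub_apply, Pi.smul_apply, seriesMul_deltaLeft_zero (S.leftSeries_of_ne _ _ _),
    seriesMul_deltaRight_zero (S.rightSeries_of_ne _ _ _),
    seriesMul_deltaIter_zero (S.iterSeries_of_ne _ _ _),
    finsum_eq_zero_of_forall_eq_zero, finsum_eq_single _ 0, zero_sub] at h
  · have hε : (-1 : ℂ) ^ (i * j).val * (-1 : ℂ) ^ (i * j).val = 1 := by
      rw [← mul_pow]; simp
    have hs : S.rightSeries v u S.vac (0, 0 - (0 : ℕ), -1 + n + 1 + (0 : ℕ)) = S.coeffY n u v := by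
      simp only [rightSeries, if_true, Nat.cast_zero, sub_zero, add_zero]
      rw [S.coeffY_apply 0 v, S.creation_zero]
      rw [show -1 + n + 1 = n by ring]
    have hn : (((-n - 1).negOnePow : ℤ) : ℂ) = -(-1 : ℂ) ^ n := by
      rw [Int.negOnePow_sub, Int.negOnePow_neg, Int.negOnePow_one, mul_neg, mul_one,
        Units.val_neg, Int.cast_neg, Int.cast_negOnePow]
    have hm : (-1 : ℂ) ^ n * (-1 : ℂ) ^ n = 1 := by
      rw [← mul_zpow]; simp
    rw [hs, mul_comm j i] at h
    simp only [pow_zero, Ring.choose_zero_right, mul_one, hn, neg_smul, smul_neg, neg_neg] at h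
    replace h := congrArg (fun x => ((-1 : ℂ) ^ (i * j).val * (-1 : ℂ) ^ n) • x) h
    simp only [smul_smul] at h
    rw [mul_assoc, mul_left_comm ((-1 : ℂ) ^ n), hm, mul_one, hε, one_smul] at h
    rw [h, mul_smul]
    congr 1
    rw [smul_finsum]
    refine finsum_congr fun q => ?_
    have hq : Ring.choose (0 + (q : ℤ)) q = 1 := by
      rw [zero_add, Ring.choose_natCast, Nat.choose_self, Nat.cast_one]
    have he : (-1 : ℤ) + 0 + 1 + q = q := by ring
    simp only [hq, iterSeries, if_true, he, coeffY_vac, mul_one, smul_smul, map_smul]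
    congr 1
    rw [zpow_sub₀ (by norm_num), zpow_natCast, div_eq_mul_inv, ← inv_pow]
    push_cast
    norm_num
    ring
  · intro q hq
    rw [rightSeries, if_pos rfl]
    dsimp only
    rw [S.coeffY_vac_of_neg _ (by omega), map_zero, smul_zero]
  · intro q
    rw [leftSeries, if_pos rfl]
    dsimp only
    rw [S.coeffY_vac_of_neg _ (by omega), map_zero, smul_zero]

end VertexOperatorSuperalgebra

/-! ### The operators `G₁(-1/2)` and `G₂(-1/2)` -/

namespace N2SuperconformalVOSA

variable {V : Type*} [AddCommGroup V] [Module ℂ V] (S : N2SuperconformalVOSA V)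

theorem G_eq_coeffY (t : V) (k : ℤ) : S.G t k = S.coeffY (-(k + 1) - 1) t := rfl

theorem Ghalf_eq_coeffY (i : Fin 2) : S.Ghalf i = S.coeffY (-1) (S.tau i) := rfl

theorem Ghalf_zero : S.Ghalf 0
    = ((Real.sqrt 2 : ℝ) : ℂ)⁻¹ • (S.G S.tauP (-1) + S.G S.tauM (-1)) := by
  rw [G_eq_coeffY, G_eq_coeffY, ← map_add, ← map_smul]
  rfl

theorem Ghalf_one : S.Ghalf 1
    = (Complex.I * ((Real.sqrt 2 : ℝ) : ℂ))⁻¹ • (S.G S.tauP (-1) - S.G S.tauM (-1)) := by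
  rw [G_eq_coeffY, G_eq_coeffY, ← map_sub, ← map_smul]
  rfl

theorem GP_sq : S.G S.tauP (-1) * S.G S.tauP (-1) = 0 := by
  have h := S.GP_GP (-1) (-1)
  rwa [← two_smul ℂ, smul_eq_zero_iff_right two_ne_zero] at h

theorem GM_sq : S.G S.tauM (-1) * S.G S.tauM (-1) = 0 := by
  have h := S.GM_GM (-1) (-1)
  rwa [← two_smul ℂ, smul_eq_zero_iff_right two_ne_zero] at h

/-- At `r = s = -1/2` the `J` term has coefficient `r - s = 0`, and the central term is absent since
`r + s ≠ 0`. -/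
theorem GP_GM_anticommutator : S.G S.tauP (-1) * S.G S.tauM (-1)
    + S.G S.tauM (-1) * S.G S.tauP (-1) = (2 : ℂ) • S.L (-1) := by
  rw [S.GP_GM]
  norm_num

/-- `G⁺(-1/2)` and `G⁻(-1/2)` square to zero, so either normalized combination squares to half their
anticommutator; for `i = 1` the factor `√-1` in the normalization corrects the sign. -/
theorem Ghalf_mul_self (i : Fin 2) : S.Ghalf i * S.Ghalf i = S.L (-1) := by
  have h2 : ((Real.sqrt 2 : ℝ) : ℂ) ^ 2 = 2 := by
    rw [← Complex.ofReal_pow, Real.sq_sqrt (by norm_num)]; norm_num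
  have key : S.L (-1) = (2 : ℂ)⁻¹ • (S.G S.tauP (-1) * S.G S.tauM (-1)
      + S.G S.tauM (-1) * S.G S.tauP (-1)) := by
    rw [GP_GM_anticommutator, smul_smul, inv_mul_cancel₀ two_ne_zero, one_smul]
  have hI : (Complex.I * ((Real.sqrt 2 : ℝ) : ℂ)) ^ 2 = -2 := by
    rw [mul_pow, h2, Complex.I_sq]; norm_num
  fin_cases i
  · rw [Fin.zero_eta, Ghalf_zero, smul_mul_smul_comm, ← mul_inv, ← sq, h2, key]
    simp only [mul_add, add_mul, GP_sq, GM_sq]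
    module
  · rw [Fin.mk_one, Ghalf_one, smul_mul_smul_comm, ← mul_inv, ← sq, hI, key]
    simp only [mul_sub, sub_mul, GP_sq, GM_sq]
    module

theorem Ghalf_one_mul_zero : S.Ghalf 1 * S.Ghalf 0 = -(S.Ghalf 0 * S.Ghalf 1) := by
  rw [Ghalf_zero, Ghalf_one, smul_mul_smul_comm, smul_mul_smul_comm]
  simp only [mul_sub, sub_mul, mul_add, add_mul, GP_sq, GM_sq]
  module

theorem Ghalf_Ghalf (i : Fin 2) (v : V) : S.Ghalf i (S.Ghalf i v) = S.L (-1) v :=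
  LinearMap.congr_fun (S.Ghalf_mul_self i) v

theorem Ghalf_one_zero (v : V) : S.Ghalf 1 (S.Ghalf 0 v) = -S.Ghalf 0 (S.Ghalf 1 v) :=
  LinearMap.congr_fun S.Ghalf_one_mul_zero v

theorem L_Ghalf (i : Fin 2) (v : V) : S.L (-1) (S.Ghalf i v) = S.Ghalf i (S.L (-1) v) := by
  rw [← Ghalf_Ghalf S i v, ← Ghalf_Ghalf S i (S.Ghalf i v)]

theorem tau_mem (i : Fin 2) : S.tau i ∈ S.sign 1 := by
  fin_cases i
  · exact Submodule.smul_mem _ _ (Submodule.add_mem _ S.tauP_mem S.tauM_mem)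
  · exact Submodule.smul_mem _ _ (Submodule.sub_mem _ S.tauP_mem S.tauM_mem)

theorem Ghalf_mem (i : Fin 2) {j : ZMod 2} {v : V} (hv : v ∈ S.sign j) :
    S.Ghalf i v ∈ S.sign (1 + j) := by
  rw [Ghalf_eq_coeffY]
  exact S.coeffY_mem (S.tau_mem i) hv (-1)

/-- `Gᵢ(-1/2)` is the residue of `Y(τᵢ, x)`, so the commutator formula makes it an odd derivation of
all products. -/
theorem Ghalf_coeffY (i : Fin 2) {j : ZMod 2} {u : V} (hu : u ∈ S.sign j) (v : V) (n : ℤ) :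
    S.Ghalf i (S.coeffY n u v) = S.coeffY n (S.Ghalf i u) v
      + (-1 : ℂ) ^ j.val • S.coeffY n u (S.Ghalf i v) := by
  have h := S.coeffY_neg_one_commutator (S.tau_mem i) hu v n
  rwa [one_mul] at h

theorem Ghalf_vac (i : Fin 2) : S.Ghalf i S.vac = 0 :=
  S.coeffY_vac_of_neg _ (by norm_num)

end N2SuperconformalVOSA

/-! ### Parity and signs in the exterior algebra -/

theorem zmod_two_eq (k : ZMod 2) : k = 0 ∨ k = 1 := by
  revert k; decide

theorem negOne_pow_val_add (a b : ZMod 2) :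
    (-1 : ℂ) ^ (a + b).val = (-1) ^ a.val * (-1) ^ b.val := by
  rcases zmod_two_eq a with rfl | rfl <;> rcases zmod_two_eq b with rfl | rfl <;>
    simp [ZMod.val_one, show (1 + 1 : ZMod 2) = 0 from rfl]

theorem negOne_pow_val_mul_self (a : ZMod 2) :
    (-1 : ℂ) ^ a.val * (-1) ^ a.val = 1 := by
  rw [← mul_pow]; simp

section Twist

variable {ι : Type}

/-- The automorphism of `ℂ[φ]` by which an operator of parity `k` moves past elements of `ℂ[φ]`. -/
def twist (k : ZMod 2) : Odd ι →ₐ[ℂ] Odd ι :=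
  if k = 0 then AlgHom.id ℂ (Odd ι) else CliffordAlgebra.involute

@[simp] theorem twist_zero (a : Odd ι) : twist 0 a = a := rfl

theorem twist_one (a : Odd ι) : twist 1 a = parityInv a := rfl

theorem twist_twist (j k : ZMod 2) (a : Odd ι) : twist j (twist k a) = twist (j + k) a := by
  rcases zmod_two_eq j with rfl | rfl <;> rcases zmod_two_eq k with rfl | rfl
  · simp
  · simp
  · simp
  · rw [twist_one, twist_one, show (1 + 1 : ZMod 2) = 0 from rfl, twist_zero]
    exact CliffordAlgebra.involute_involute a

theorem twist_ι (k : ZMod 2) (x : ι → ℂ) :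
    twist k (ExteriorAlgebra.ι ℂ x) = (-1 : ℂ) ^ k.val • ExteriorAlgebra.ι ℂ x := by
  rcases zmod_two_eq k with rfl | rfl
  · simp
  · rw [ZMod.val_one, pow_one, neg_one_smul]
    exact CliffordAlgebra.involute_ι x

theorem ι_mul (x : ι → ℂ) (b : Odd ι) :
    ExteriorAlgebra.ι ℂ x * b = twist 1 b * ExteriorAlgebra.ι ℂ x := by
  induction b using ExteriorAlgebra.induction with
  | algebraMap r => rw [AlgHom.commutes, Algebra.commutes]
  | ι y =>
    rw [twist_ι, ZMod.val_one, pow_one, neg_one_smul, neg_mul]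
    exact eq_neg_of_add_eq_zero_left (ExteriorAlgebra.ι_add_mul_swap x y)
  | mul a b ha hb => rw [← mul_assoc, ha, mul_assoc, hb, map_mul, mul_assoc]
  | add a b ha hb => rw [mul_add, ha, hb, map_add, add_mul]

/-- Elements `a` of `ℂ[φ]` of parity `k`. -/
structure HasParity (k : ZMod 2) (a : Odd ι) : Prop where
  twist_eq : ∀ j, twist j a = (-1 : ℂ) ^ (j * k).val • a
  mul_eq : ∀ b, a * b = twist k b * a

theorem hasParity_one : HasParity 0 (1 : Odd ι) := ⟨fun j => by simp, fun b => by simp⟩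

theorem hasParity_ι (x : ι → ℂ) : HasParity 1 (ExteriorAlgebra.ι ℂ x) :=
  ⟨fun j => by rw [mul_one, twist_ι], ι_mul x⟩

theorem HasParity.mul {j k : ZMod 2} {a b : Odd ι} (ha : HasParity j a) (hb : HasParity k b) :
    HasParity (j + k) (a * b) where
  twist_eq l := by
    rw [map_mul, ha.twist_eq, hb.twist_eq, smul_mul_smul_comm, mul_add, negOne_pow_val_add]
  mul_eq c := by
    rw [mul_assoc, hb.mul_eq, ← mul_assoc, ha.mul_eq, twist_twist, mul_assoc]

theorem HasParity.mul_comm {j k : ZMod 2} {a b : Odd ι} (ha : HasParity j a)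
    (hb : HasParity k b) : b * a = (-1 : ℂ) ^ (j * k).val • (a * b) := by
  rw [ha.mul_eq, hb.twist_eq, smul_mul_assoc, smul_smul, negOne_pow_val_mul_self, one_smul]

end Twist

/-! ### The vertex operator map on `V[φ]` -/

namespace VertexOperatorSuperalgebra

variable {V : Type*} [AddCommGroup V] [Module ℂ V] (S : VertexOperatorSuperalgebra V)
  {ι : Type}

theorem projEven_of_mem {v : V} (hv : v ∈ S.sign 0) : S.projEven v = v :=
  Submodule.projection_apply_left S.isCompl_sign ⟨v, hv⟩

theorem projEven_of_mem_odd {v : V} (hv : v ∈ S.sign 1) : S.projEven v = 0 :=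
  (Submodule.projection_apply_eq_zero_iff S.isCompl_sign).2 hv

theorem projOdd_of_mem {v : V} (hv : v ∈ S.sign 1) : S.projOdd v = v :=
  Submodule.projection_apply_left S.isCompl_sign.symm ⟨v, hv⟩

theorem projOdd_of_mem_even {v : V} (hv : v ∈ S.sign 0) : S.projOdd v = 0 :=
  (Submodule.projection_apply_eq_zero_iff S.isCompl_sign.symm).2 hv

theorem sign_induction {p : V → Prop} (v : V) (mem : ∀ j, ∀ v ∈ S.sign j, p v)
    (add : ∀ v w, p v → p w → p (v + w)) : p v := by
  obtain ⟨x, hx, y, hy, rfl⟩ := Submodule.mem_sup.1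
    (S.isCompl_sign.sup_eq_top ▸ Submodule.mem_top : v ∈ S.sign 0 ⊔ S.sign 1)
  exact add _ _ (mem 0 x hx) (mem 1 y hy)

theorem evenPart_add_oddPart (A : Module.End ℂ V) : S.evenPart A + S.oddPart A = A := by
  have h (v : V) : S.projEven v + S.projOdd v = v := by
    induction v using S.sign_induction with
    | mem j v hv =>
      rcases zmod_two_eq j with rfl | rfl
      · rw [S.projEven_of_mem hv, S.projOdd_of_mem_even hv, add_zero]
      · rw [S.projEven_of_mem_odd hv, S.projOdd_of_mem hv, zero_add]
    | add v w hv hw => rw [map_add, map_add, add_add_add_comm, hv, hw]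
  ext v
  simp only [evenPart, oddPart, LinearMap.add_apply, LinearMap.mulLeftRight_apply,
    Module.End.mul_apply]
  calc _ = (S.projEven (A (S.projEven v)) + S.projOdd (A (S.projEven v)))
      + (S.projEven (A (S.projOdd v)) + S.projOdd (A (S.projOdd v))) := by abel
    _ = A v := by rw [h, h, ← map_add, h]

theorem evenPart_of_even {A : Module.End ℂ V} (hA : ∀ j, ∀ v ∈ S.sign j, A v ∈ S.sign j) :
    S.evenPart A = A := by
  ext v
  induction v using S.sign_induction with
  | mem j v hv =>
    have h := hA j v hv
    rcases zmod_two_eq j with rfl | rfl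
    · simp [evenPart, S.projEven_of_mem hv, S.projOdd_of_mem_even hv, S.projEven_of_mem h]
    · simp [evenPart, S.projEven_of_mem_odd hv, S.projOdd_of_mem hv, S.projOdd_of_mem h]
  | add v w hv hw => rw [map_add, map_add, hv, hw]

theorem oddPart_of_odd {A : Module.End ℂ V} (hA : ∀ j, ∀ v ∈ S.sign j, A v ∈ S.sign (1 + j)) :
    S.oddPart A = A := by
  ext v
  induction v using S.sign_induction with
  | mem j v hv =>
    have h := hA j v hv
    rcases zmod_two_eq j with rfl | rfl
    · rw [add_zero] at h
      simp [oddPart, S.projEven_of_mem hv, S.projOdd_of_mem_even hv, S.projOdd_of_mem h]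
    · rw [show (1 + 1 : ZMod 2) = 0 from rfl] at h
      simp [oddPart, S.projEven_of_mem_odd hv, S.projOdd_of_mem hv, S.projEven_of_mem h]
  | add v w hv hw => rw [map_add, map_add, hv, hw]

theorem superAct_tmul (a b : Odd ι) (A : Module.End ℂ V) (w : V) :
    S.superAct (a ⊗ₜ A) (b ⊗ₜ w)
      = (a * b) ⊗ₜ S.evenPart A w + (a * parityInv b) ⊗ₜ S.oddPart A w := rfl

/-- No odd variable has to be crossed, so no sign appears and `A` need not be homogeneous. -/
theorem superAct_tmul_one (a : Odd ι) (A : Module.End ℂ V) (w : V) :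
    S.superAct (a ⊗ₜ A) (1 ⊗ₜ w) = a ⊗ₜ A w := by
  rw [superAct_tmul, ← twist_one, map_one, mul_one, ← TensorProduct.tmul_add,
    ← LinearMap.add_apply, evenPart_add_oddPart]

/-- For homogeneous `A` one of its two parts is `A` and the other is zero, so the Koszul sign
becomes a single `twist`. -/
theorem superAct_tmul_of_parity {k : ZMod 2} {A : Module.End ℂ V}
    (hA : ∀ j, ∀ v ∈ S.sign j, A v ∈ S.sign (k + j)) (a b : Odd ι) (w : V) :
    S.superAct (a ⊗ₜ A) (b ⊗ₜ w) = (a * twist k b) ⊗ₜ A w := by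
  have h := S.evenPart_add_oddPart A
  rw [superAct_tmul]
  rcases zmod_two_eq k with rfl | rfl
  · rw [S.evenPart_of_even (by simpa using hA)] at h ⊢
    rw [add_eq_left.1 h]
    simp
  · rw [S.oddPart_of_odd hA] at h ⊢
    rw [add_eq_right.1 h]
    simp [twist_one]

theorem superAct_smul (a : Odd ι) (T : Odd ι ⊗[ℂ] Module.End ℂ V) (X : Odd ι ⊗[ℂ] V) :
    S.superAct (a • T) X = a • S.superAct T X := by
  induction T with
  | zero => simp
  | add T T' h h' => rw [smul_add, map_add, map_add, LinearMap.add_apply, LinearMap.add_apply,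
      smul_add, h, h']
  | tmul b A =>
    induction X with
    | zero => simp
    | add X X' h h' => rw [map_add, map_add, smul_add, h, h']
    | tmul c w =>
      simp only [TensorProduct.smul_tmul', smul_eq_mul, superAct_tmul, smul_add, mul_assoc]

theorem tensor_induction {p : Odd ι ⊗[ℂ] V → Prop} (X : Odd ι ⊗[ℂ] V)
    (tmul : ∀ j a, ∀ v ∈ S.sign j, p (a ⊗ₜ v)) (add : ∀ X Y, p X → p Y → p (X + Y)) : p X := by
  induction X with
  | zero => simpa using tmul 0 0 0 (zero_mem _)
  | add X Y h h' => exact add X Y h h'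
  | tmul a v =>
    induction v using S.sign_induction with
    | mem j v hv => exact tmul j a v hv
    | add v w hv hw => rw [TensorProduct.tmul_add]; exact add _ _ hv hw

/-- The vertex operator map on `V[φ]`: the coefficient of `x ^ n` in `Y(U, x) W`. -/
def oddMul (n : ℤ) : Odd ι ⊗[ℂ] V →ₗ[ℂ] Odd ι ⊗[ℂ] V →ₗ[ℂ] Odd ι ⊗[ℂ] V :=
  S.superAct ∘ₗ (S.coeffY n).lTensor (Odd ι)

theorem oddMul_apply (n : ℤ) (U : Odd ι ⊗[ℂ] V) :
    S.oddMul n U = S.superAct ((S.coeffY n).lTensor (Odd ι) U) := rfl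

theorem oddMul_tmul (n : ℤ) {j : ZMod 2} {u : V} (hu : u ∈ S.sign j) (a b : Odd ι) (w : V) :
    S.oddMul n (a ⊗ₜ u) (b ⊗ₜ w) = (a * twist j b) ⊗ₜ S.coeffY n u w :=
  S.superAct_tmul_of_parity (fun _ _ hv => S.coeffY_mem hu hv n) a b w

theorem oddMul_tmul_one (n : ℤ) (a : Odd ι) (u w : V) :
    S.oddMul n (a ⊗ₜ u) (1 ⊗ₜ w) = a ⊗ₜ S.coeffY n u w :=
  S.superAct_tmul_one a _ w

theorem lTensor_smul (f : V →ₗ[ℂ] Module.End ℂ V) (a : Odd ι) (U : Odd ι ⊗[ℂ] V) :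
    f.lTensor (Odd ι) (a • U) = a • f.lTensor (Odd ι) U := by
  induction U with
  | zero => simp
  | add X X' h h' => simp only [map_add, smul_add, h, h']
  | tmul c w => simp [TensorProduct.smul_tmul']

theorem oddMul_smul (n : ℤ) (a : Odd ι) (U W : Odd ι ⊗[ℂ] V) :
    S.oddMul n (a • U) W = a • S.oddMul n U W := by
  rw [oddMul_apply, lTensor_smul, superAct_smul, oddMul_apply]

/-- `L(-1)` on `V[φ]`. -/
def oddL : Module.End ℂ (Odd ι ⊗[ℂ] V) := (S.L (-1)).lTensor (Odd ι)

theorem oddL_tmul (a : Odd ι) (v : V) : S.oddL (a ⊗ₜ v) = a ⊗ₜ S.L (-1) v := rfl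

theorem L_mem {j : ZMod 2} {v : V} (hv : v ∈ S.sign j) : S.L (-1) v ∈ S.sign j := by
  have h := S.coeffY_mem S.omega_mem hv (-1)
  rwa [zero_add] at h

theorem superAct_one_tmul_L : S.superAct ((1 : Odd ι) ⊗ₜ S.L (-1)) = S.oddL := by
  ext a v
  exact (S.superAct_tmul_of_parity (k := 0)
    (fun j v hv => by simpa using S.L_mem hv) 1 a v).trans (by simp [oddL_tmul])

theorem oddL_smul (a : Odd ι) (U : Odd ι ⊗[ℂ] V) : S.oddL (a • U) = a • S.oddL U := by
  induction U with
  | zero => simp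
  | add X X' h h' => simp only [map_add, smul_add, h, h']
  | tmul c w => simp [TensorProduct.smul_tmul', oddL_tmul]

theorem oddMul_oddL (n : ℤ) (U W : Odd ι ⊗[ℂ] V) :
    S.oddMul n (S.oddL U) W = ((n : ℂ) + 1) • S.oddMul (n + 1) U W := by
  induction U with
  | zero => simp
  | add X X' h h' => simp only [map_add, LinearMap.add_apply, smul_add, h, h']
  | tmul c w =>
    rw [oddMul_apply, oddL_tmul, LinearMap.lTensor_tmul, coeffY_L, TensorProduct.tmul_smul,
      map_smul]
    rfl

theorem exists_oddMul_eq_zero (U W : Odd ι ⊗[ℂ] V) : ∃ N : ℤ, ∀ n < N, S.oddMul n U W = 0 := by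
  induction U using S.tensor_induction with
  | add X Y h h' =>
    obtain ⟨N, hN⟩ := h
    obtain ⟨N', hN'⟩ := h'
    refine ⟨min N N', fun n hn => ?_⟩
    rw [map_add, LinearMap.add_apply, hN n (by omega), hN' n (by omega), add_zero]
  | tmul j a u hu =>
    induction W using S.tensor_induction with
    | add X Y h h' =>
      obtain ⟨N, hN⟩ := h
      obtain ⟨N', hN'⟩ := h'
      refine ⟨min N N', fun n hn => ?_⟩
      rw [map_add, hN n (by omega), hN' n (by omega), add_zero]
    | tmul k b v hv =>
      obtain ⟨N, hN⟩ := S.exists_coeffY_eq_zero u v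
      refine ⟨N, fun n hn => ?_⟩
      rw [S.oddMul_tmul n hu, hN n hn, TensorProduct.tmul_zero]

end VertexOperatorSuperalgebra

/-! ### Exponentials of `θ₁G₁(-1/2) + θ₂G₂(-1/2)` -/

namespace N2SuperconformalVOSA

variable {V : Type*} [AddCommGroup V] [Module ℂ V] (S : N2SuperconformalVOSA V) {ι : Type}

/-- The operator `θ G_i(-1/2)` on `V[φ]` for an odd element `θ` of degree one. -/
def oddG (i : Fin 2) (x : ι → ℂ) : Module.End ℂ (Odd ι ⊗[ℂ] V) :=
  S.superAct (ExteriorAlgebra.ι ℂ x ⊗ₜ S.Ghalf i)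

theorem oddG_tmul (i : Fin 2) (x : ι → ℂ) (a : Odd ι) (v : V) :
    S.oddG i x (a ⊗ₜ v) = (ExteriorAlgebra.ι ℂ x * twist 1 a) ⊗ₜ S.Ghalf i v :=
  S.superAct_tmul_of_parity (fun _ _ hv => S.Ghalf_mem i hv) _ _ _

theorem oddG_add (i : Fin 2) (x y : ι → ℂ) : S.oddG i (x + y) = S.oddG i x + S.oddG i y := by
  rw [oddG, map_add, TensorProduct.add_tmul, map_add]; rfl

theorem oddG_neg (i : Fin 2) (x : ι → ℂ) : S.oddG i (-x) = -S.oddG i x := by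
  rw [oddG, map_neg, TensorProduct.neg_tmul, map_neg]; rfl

theorem oddG_sub (i : Fin 2) (x y : ι → ℂ) : S.oddG i (x - y) = S.oddG i x - S.oddG i y := by
  rw [sub_eq_add_neg, oddG_add, oddG_neg]
  exact (sub_eq_add_neg (S.oddG i x) (S.oddG i y)).symm

/-- Moving `a` out past `Gᵢ` and then past `θ` applies the parity involution twice: `θGᵢ` is even in
total. -/
theorem oddG_smul (i : Fin 2) (x : ι → ℂ) (a : Odd ι) (U : Odd ι ⊗[ℂ] V) :
    S.oddG i x (a • U) = a • S.oddG i x U := by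
  induction U with
  | zero => simp
  | add X X' h h' => simp only [map_add, smul_add, h, h']
  | tmul c w =>
    simp only [TensorProduct.smul_tmul', smul_eq_mul, oddG_tmul, map_mul, ← mul_assoc]
    rw [ι_mul, twist_twist, show (1 + 1 : ZMod 2) = 0 from rfl, twist_zero]

theorem ι_mul_twist (x y : ι → ℂ) (a : Odd ι) :
    ExteriorAlgebra.ι ℂ x * twist 1 (ExteriorAlgebra.ι ℂ y * twist 1 a)
      = -(ExteriorAlgebra.ι ℂ x * ExteriorAlgebra.ι ℂ y * a) := by
  rw [map_mul, twist_twist, twist_ι, ZMod.val_one, pow_one, neg_one_smul,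
    show (1 + 1 : ZMod 2) = 0 from rfl, twist_zero, neg_mul, mul_neg, mul_assoc]

theorem oddG_oddG (i : Fin 2) (x y : ι → ℂ) (U : Odd ι ⊗[ℂ] V) :
    S.oddG i x (S.oddG i y U)
      = -((ExteriorAlgebra.ι ℂ x * ExteriorAlgebra.ι ℂ y) • S.oddL U) := by
  induction U with
  | zero => simp
  | add X X' h h' => simp only [map_add, smul_add, h, h', neg_add]
  | tmul c w =>
    rw [oddG_tmul, oddG_tmul, Ghalf_Ghalf, ι_mul_twist, S.oddL_tmul, TensorProduct.smul_tmul',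
      smul_eq_mul, TensorProduct.neg_tmul]

theorem oddG_oddG_self (i : Fin 2) (x : ι → ℂ) (U : Odd ι ⊗[ℂ] V) :
    S.oddG i x (S.oddG i x U) = 0 := by
  rw [oddG_oddG, ExteriorAlgebra.ι_sq_zero, zero_smul, neg_zero]

/-- The variables anticommute and so do `G₁(-1/2)`, `G₂(-1/2)`; the two signs cancel. -/
theorem oddG_comm (x y : ι → ℂ) (U : Odd ι ⊗[ℂ] V) :
    S.oddG 1 y (S.oddG 0 x U) = S.oddG 0 x (S.oddG 1 y U) := by
  induction U with
  | zero => simp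
  | add X X' h h' => simp only [map_add, h, h']
  | tmul c w =>
    have hxy : ExteriorAlgebra.ι ℂ y * ExteriorAlgebra.ι ℂ x
        = -(ExteriorAlgebra.ι ℂ x * ExteriorAlgebra.ι ℂ y) :=
      eq_neg_of_add_eq_zero_left (ExteriorAlgebra.ι_add_mul_swap y x)
    rw [oddG_tmul, oddG_tmul, oddG_tmul, oddG_tmul, Ghalf_one_zero, ι_mul_twist, ι_mul_twist,
      hxy, neg_mul, neg_neg, TensorProduct.tmul_neg, TensorProduct.neg_tmul]

theorem oddG_oddL (i : Fin 2) (x : ι → ℂ) (U : Odd ι ⊗[ℂ] V) :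
    S.oddG i x (S.oddL U) = S.oddL (S.oddG i x U) := by
  induction U with
  | zero => simp
  | add X X' h h' => simp only [map_add, h, h']
  | tmul c w => rw [S.oddL_tmul, oddG_tmul, oddG_tmul, S.oddL_tmul, L_Ghalf]

/-- `θ G_i(-1/2)` is a derivation of the vertex operator map on `V[φ]`. -/
theorem oddG_oddMul (i : Fin 2) (x : ι → ℂ) (n : ℤ) (U W : Odd ι ⊗[ℂ] V) :
    S.oddG i x (S.oddMul n U W)
      = S.oddMul n (S.oddG i x U) W + S.oddMul n U (S.oddG i x W) := by
  induction U using S.tensor_induction with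
  | add X Y h h' => simp only [map_add, LinearMap.add_apply, h, h']; abel
  | tmul j a u hu =>
    induction W with
    | zero => simp
    | add X Y h h' => simp only [map_add, h, h']; abel
    | tmul b w =>
      have hxa : ExteriorAlgebra.ι ℂ x * twist 1 a = a * ExteriorAlgebra.ι ℂ x := by
        rw [ι_mul, twist_twist, show (1 + 1 : ZMod 2) = 0 from rfl, twist_zero]
      rw [S.oddMul_tmul n hu, oddG_tmul, oddG_tmul, S.oddMul_tmul n (S.Ghalf_mem i hu), oddG_tmul,
        S.oddMul_tmul n hu, S.Ghalf_coeffY i hu, TensorProduct.tmul_add, TensorProduct.tmul_smul,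
        TensorProduct.smul_tmul', map_mul, map_mul, twist_twist, twist_twist, twist_ι,
        add_comm j 1, mul_assoc, smul_mul_assoc, mul_smul_comm, ← mul_assoc, ← mul_assoc,
        hxa]

/-- `e^(θ₁ G₁(-1/2) + θ₂ G₂(-1/2))`, where `θ_i` is the degree one element given by `x i`. -/
def oddExp (x : Fin 2 → ι → ℂ) : Module.End ℂ (Odd ι ⊗[ℂ] V) :=
  (1 + S.oddG 0 (x 0)) * (1 + S.oddG 1 (x 1))

/-- For a derivation `D` with `D² = 0`, applying `D²` to `Y(U, x)W` gives `2 Y(DU, x)DW = 0`. Hence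
`1 + D`, which is `e^D`, is multiplicative. -/
theorem one_add_oddG_oddMul (i : Fin 2) (x : ι → ℂ) (n : ℤ) (U W : Odd ι ⊗[ℂ] V) :
    (1 + S.oddG i x) (S.oddMul n U W)
      = S.oddMul n ((1 + S.oddG i x) U) ((1 + S.oddG i x) W) := by
  have h : S.oddMul n (S.oddG i x U) (S.oddG i x W) = 0 := by
    have h2 := S.oddG_oddG_self i x (S.oddMul n U W)
    rw [oddG_oddMul, map_add, oddG_oddMul, oddG_oddMul, oddG_oddG_self, oddG_oddG_self, map_zero,
      map_zero, LinearMap.zero_apply, zero_add, add_zero, ← two_smul ℂ] at h2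
    exact (smul_eq_zero_iff_right two_ne_zero).1 h2
  simp only [LinearMap.add_apply, Module.End.one_apply, map_add, oddG_oddMul, h]
  abel

theorem oddExp_oddMul (x : Fin 2 → ι → ℂ) (n : ℤ) (U W : Odd ι ⊗[ℂ] V) :
    S.oddExp x (S.oddMul n U W) = S.oddMul n (S.oddExp x U) (S.oddExp x W) := by
  simp only [oddExp, Module.End.mul_apply, one_add_oddG_oddMul]

theorem oddExp_smul (x : Fin 2 → ι → ℂ) (a : Odd ι) (U : Odd ι ⊗[ℂ] V) :
    S.oddExp x (a • U) = a • S.oddExp x U := by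
  simp only [oddExp, Module.End.mul_apply, LinearMap.add_apply, Module.End.one_apply, map_add,
    oddG_smul, smul_add]

/-- Explains the order of factors in the odd vertex operator: `θ₁G₁θ₂G₂ = -θ₁θ₂G₁G₂ = θ₁θ₂G₂G₁`. -/
theorem oddExp_one_tmul (x : Fin 2 → ι → ℂ) (u : V) :
    S.oddExp x (1 ⊗ₜ u) = 1 ⊗ₜ u + ExteriorAlgebra.ι ℂ (x 0) ⊗ₜ S.Ghalf 0 u
      + ExteriorAlgebra.ι ℂ (x 1) ⊗ₜ S.Ghalf 1 u
      + (ExteriorAlgebra.ι ℂ (x 0) * ExteriorAlgebra.ι ℂ (x 1)) ⊗ₜ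
        S.Ghalf 1 (S.Ghalf 0 u) := by
  simp only [oddExp, Module.End.mul_apply, LinearMap.add_apply, Module.End.one_apply, map_add,
    oddG_tmul, map_one, mul_one, twist_ι, Ghalf_one_zero, ZMod.val_one, pow_one, neg_smul,
    one_smul, mul_neg, TensorProduct.tmul_neg, TensorProduct.neg_tmul]
  abel

theorem odd_neg_smul (a : Odd ι) (U : Odd ι ⊗[ℂ] V) : (-a) • U = -(a • U) :=
  neg_smul a U

theorem ι_smul_oddG (i : Fin 2) (x : ι → ℂ) (U : Odd ι ⊗[ℂ] V) :
    ExteriorAlgebra.ι ℂ x • S.oddG i x U = 0 := by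
  induction U with
  | zero => simp
  | add X X' h h' => rw [map_add, smul_add, h, h', add_zero]
  | tmul c w =>
    rw [oddG_tmul, TensorProduct.smul_tmul', smul_eq_mul, ← mul_assoc,
      ExteriorAlgebra.ι_sq_zero, zero_mul, TensorProduct.zero_tmul]

theorem ι_mul_ι_swap (x y : ι → ℂ) :
    ExteriorAlgebra.ι ℂ x * ExteriorAlgebra.ι ℂ y
      = -(ExteriorAlgebra.ι ℂ y * ExteriorAlgebra.ι ℂ x) :=
  eq_neg_of_add_eq_zero_left (ExteriorAlgebra.ι_add_mul_swap x y)

/-- The Baker-Campbell-Hausdorff formula for one of the pairs of odd variables. -/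
theorem one_add_oddG_mul (i : Fin 2) (x y : ι → ℂ) (U : Odd ι ⊗[ℂ] V) :
    (1 + S.oddG i y) ((1 + S.oddG i (x - y)) U) = (1 + S.oddG i x) U
      + (ExteriorAlgebra.ι ℂ x * ExteriorAlgebra.ι ℂ y) • S.oddL ((1 + S.oddG i x) U) := by
  -- The variable `x` occurs twice, so the correction term is unchanged when `1 + θGᵢ` is inserted
  -- in it.
  have h : (ExteriorAlgebra.ι ℂ x * ExteriorAlgebra.ι ℂ y) • S.oddG i x (S.oddL U) = 0 := by
    rw [ι_mul_ι_swap, odd_neg_smul, mul_smul, ι_smul_oddG, smul_zero, neg_zero]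
  rw [oddG_oddL] at h
  simp only [LinearMap.add_apply, LinearMap.sub_apply, Module.End.one_apply, map_add, map_sub,
    oddG_sub, oddG_oddG S i y x, oddG_oddG_self, smul_add, h, ι_mul_ι_swap y x, odd_neg_smul]
  abel

theorem one_add_oddG_comm (x y : ι → ℂ) (U : Odd ι ⊗[ℂ] V) :
    (1 + S.oddG 1 y) ((1 + S.oddG 0 x) U) = (1 + S.oddG 0 x) ((1 + S.oddG 1 y) U) := by
  simp only [LinearMap.add_apply, Module.End.one_apply, map_add, oddG_comm]
  abel

theorem hasParity_ι_mul_ι (x y : ι → ℂ) :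
    HasParity 0 (ExteriorAlgebra.ι ℂ x * ExteriorAlgebra.ι ℂ y) :=
  (hasParity_ι x).mul (hasParity_ι y)

theorem ι_mul_ι_sq (x y : ι → ℂ) :
    ExteriorAlgebra.ι ℂ x * ExteriorAlgebra.ι ℂ y
      * (ExteriorAlgebra.ι ℂ x * ExteriorAlgebra.ι ℂ y) = 0 := by
  rw [mul_assoc, ← mul_assoc (ExteriorAlgebra.ι ℂ y), ι_mul_ι_swap y x, neg_mul, mul_assoc,
    ExteriorAlgebra.ι_sq_zero, mul_zero, neg_zero, mul_zero]

/-- The two summands commute and square to zero, so only the cross term survives; a third factor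
repeats a summand, whence the cube vanishes. -/
theorem shift_sq (x y : Fin 2 → ι → ℂ) :
    (ExteriorAlgebra.ι ℂ (x 0) * ExteriorAlgebra.ι ℂ (y 0)
      + ExteriorAlgebra.ι ℂ (x 1) * ExteriorAlgebra.ι ℂ (y 1)) ^ 2
    = (2 : ℂ) • (ExteriorAlgebra.ι ℂ (x 0) * ExteriorAlgebra.ι ℂ (y 0)
      * (ExteriorAlgebra.ι ℂ (x 1) * ExteriorAlgebra.ι ℂ (y 1))) := by
  rw [sq, mul_add, add_mul, add_mul, ι_mul_ι_sq, ι_mul_ι_sq,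
    (hasParity_ι_mul_ι (x 1) (y 1)).mul_eq, twist_zero]
  module

theorem shift_pow_three (x y : Fin 2 → ι → ℂ) :
    (ExteriorAlgebra.ι ℂ (x 0) * ExteriorAlgebra.ι ℂ (y 0)
      + ExteriorAlgebra.ι ℂ (x 1) * ExteriorAlgebra.ι ℂ (y 1)) ^ 3 = 0 := by
  have h : ExteriorAlgebra.ι ℂ (x 1) * ExteriorAlgebra.ι ℂ (y 1)
      * (ExteriorAlgebra.ι ℂ (x 0) * ExteriorAlgebra.ι ℂ (y 0))
      = ExteriorAlgebra.ι ℂ (x 0) * ExteriorAlgebra.ι ℂ (y 0)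
      * (ExteriorAlgebra.ι ℂ (x 1) * ExteriorAlgebra.ι ℂ (y 1)) :=
    (hasParity_ι_mul_ι (x 1) (y 1)).mul_eq _
  rw [pow_succ, shift_sq, smul_mul_assoc, mul_add, mul_assoc, h, ← mul_assoc, ι_mul_ι_sq,
    mul_assoc, ι_mul_ι_sq, zero_mul, mul_zero, add_zero, smul_zero]

/-- Each pair of variables contributes a factor `1 + θᵢηᵢL(-1)`, and the product of these two
factors is `1 + sL(-1) + s²L(-1)²/2 = e^(sL(-1))`. -/
theorem oddExp_oddExp_sub (x y : Fin 2 → ι → ℂ) {s : Odd ι}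
    (hs : s = ExteriorAlgebra.ι ℂ (x 0) * ExteriorAlgebra.ι ℂ (y 0)
      + ExteriorAlgebra.ι ℂ (x 1) * ExteriorAlgebra.ι ℂ (y 1)) (U : Odd ι ⊗[ℂ] V) :
    S.oddExp y (S.oddExp (x - y) U) = S.oddExp x U + s • S.oddL (S.oddExp x U)
      + (1 / 2 : ℂ) • s ^ 2 • S.oddL (S.oddL (S.oddExp x U)) := by
  have h (a : Odd ι) (U : Odd ι ⊗[ℂ] V) : (1 + S.oddG 0 (x 0)) (U + a • S.oddL U)
      = (1 + S.oddG 0 (x 0)) U + a • S.oddL ((1 + S.oddG 0 (x 0)) U) := by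
    simp only [LinearMap.add_apply, Module.End.one_apply, map_add, oddG_smul, oddG_oddL, smul_add]
  rw [hs, shift_sq, smul_assoc, smul_smul]
  simp only [oddExp, Module.End.mul_apply, Pi.sub_apply]
  -- Exchanging the two middle factors brings together the factors with the same index.
  rw [one_add_oddG_comm, one_add_oddG_mul, one_add_oddG_mul, h]
  simp only [map_add, S.oddL_smul, smul_add, add_smul, smul_smul]
  norm_num
  abel

/-- Absorbs the odd variables into the vector, leaving the ordinary vertex operator map on `V[φ]`.
-/
theorem oddY_eq (x : Fin 2 → ι → ℂ) (n : ℤ) (u : V) :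
    S.oddY (fun i => ExteriorAlgebra.ι ℂ (x i)) n u
      = (S.coeffY n).lTensor (Odd ι) (S.oddExp x (1 ⊗ₜ u)) := by
  rw [oddExp_one_tmul]; simp [oddY]

theorem oddYApply_eq (x : Fin 2 → ι → ℂ) (n : ℤ) (u v : V) :
    S.oddYApply (fun i => ExteriorAlgebra.ι ℂ (x i)) u v n
      = S.oddMul n (S.oddExp x (1 ⊗ₜ u)) (1 ⊗ₜ v) := by
  rw [oddYApply, oddY_eq, S.oddMul_apply]

theorem oddYExt_eq (x : Fin 2 → ι → ℂ) (n : ℤ) (U : Odd ι ⊗[ℂ] V) :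
    S.oddYExt (fun i => ExteriorAlgebra.ι ℂ (x i)) n U
      = (S.coeffY n).lTensor (Odd ι) (S.oddExp x U) := by
  induction U with
  | zero => simp
  | add X X' h h' => simp only [map_add, h, h']
  | tmul a u =>
    have h : a ⊗ₜ[ℂ] u = a • ((1 : Odd ι) ⊗ₜ[ℂ] u) := by
      rw [TensorProduct.smul_tmul', smul_eq_mul, mul_one]
    rw [h, oddExp_smul, VertexOperatorSuperalgebra.lTensor_smul, ← oddY_eq, ← h]
    rfl

end N2SuperconformalVOSA

/-! ### Jacobi identity and skew-symmetry on `V[φ]` -/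

namespace VertexOperatorSuperalgebra

variable {V : Type*} [AddCommGroup V] [Module ℂ V] (S : VertexOperatorSuperalgebra V)
  {ι : Type}

/-- The even (`p = 0`) or odd (`p = 1`) part of `V[φ]`, where the odd variables are odd. -/
def oddSign (p : ZMod 2) : AddSubmonoid (Odd ι ⊗[ℂ] V) :=
  AddSubmonoid.closure {X | ∃ (i j : ZMod 2) (a : Odd ι) (v : V),
    i + j = p ∧ HasParity i a ∧ v ∈ S.sign j ∧ X = a ⊗ₜ v}

theorem tmul_mem_oddSign {i j : ZMod 2} {a : Odd ι} {v : V} (ha : HasParity i a)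
    (hv : v ∈ S.sign j) : a ⊗ₜ[ℂ] v ∈ S.oddSign (i + j) :=
  AddSubmonoid.subset_closure ⟨i, j, a, v, rfl, ha, hv, rfl⟩

/-- The three products in the Jacobi identity for `V[φ]`, as series in `x₀, x₁, x₂`. -/
def oddLeft (U W X : Odd ι ⊗[ℂ] V) : ℤ × ℤ × ℤ → Odd ι ⊗[ℂ] V := fun e =>
  if e.1 = 0 then S.oddMul e.2.1 U (S.oddMul e.2.2 W X) else 0

def oddRight (U W X : Odd ι ⊗[ℂ] V) : ℤ × ℤ × ℤ → Odd ι ⊗[ℂ] V := fun e =>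
  if e.1 = 0 then S.oddMul e.2.2 W (S.oddMul e.2.1 U X) else 0

def oddIter (U W X : Odd ι ⊗[ℂ] V) : ℤ × ℤ × ℤ → Odd ι ⊗[ℂ] V := fun e =>
  if e.2.1 = 0 then S.oddMul e.2.2 (S.oddMul e.1 U W) X else 0

theorem productExists_oddLeft (U W X : Odd ι ⊗[ℂ] V) :
    ProductExists (deltaLeft (0 : Odd ι)) (S.oddLeft U W X) := by
  obtain ⟨N, hN⟩ := S.exists_oddMul_eq_zero W X
  exact productExists_deltaLeft_zero (N := N) (fun e he => if_neg he)
    fun e he => by simp [oddLeft, hN _ he]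

theorem productExists_oddRight (U W X : Odd ι ⊗[ℂ] V) :
    ProductExists (deltaRight (0 : Odd ι)) (S.oddRight U W X) := by
  obtain ⟨N, hN⟩ := S.exists_oddMul_eq_zero U X
  exact productExists_deltaRight_zero (N := N) (fun e he => if_neg he)
    fun e he => by simp [oddRight, hN _ he]

theorem productExists_oddIter (U W X : Odd ι ⊗[ℂ] V) :
    ProductExists (deltaIter (0 : Odd ι)) (S.oddIter U W X) := by
  obtain ⟨N, hN⟩ := S.exists_oddMul_eq_zero U W
  exact productExists_deltaIter_zero (N := N) (fun e he => if_neg he)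
    fun e he => by simp [oddIter, hN _ he]

/-- Collecting `ab` on the left costs `(-1)^(ji')` in the first product and in the iterate, and
`(-1)^(j'i + ii')` in the second product. Together with `(-1)^(jj')` from the identity on `V`, this
yields the sign for the total parities `i + j` and `i' + j'`. -/
theorem jacobi_tmul {i i' j j' : ZMod 2} {a b : Odd ι} {u v : V} (ha : HasParity i a)
    (hb : HasParity i' b) (hu : u ∈ S.sign j) (hv : v ∈ S.sign j') (w : V) :
    seriesMul (deltaLeft (0 : Odd ι)) (S.oddLeft (a ⊗ₜ u) (b ⊗ₜ v) (1 ⊗ₜ w))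
      - (-1 : ℂ) ^ ((i + j) * (i' + j')).val •
        seriesMul (deltaRight (0 : Odd ι)) (S.oddRight (a ⊗ₜ u) (b ⊗ₜ v) (1 ⊗ₜ w))
      = seriesMul (deltaIter (0 : Odd ι)) (S.oddIter (a ⊗ₜ u) (b ⊗ₜ v) (1 ⊗ₜ w)) := by
  have hl : S.oddLeft (a ⊗ₜ u) (b ⊗ₜ v) (1 ⊗ₜ w) = fun e =>
      ((-1 : ℂ) ^ (j * i').val • TensorProduct.mk ℂ (Odd ι) V (a * b)) (S.leftSeries u v w e) := by
    ext e
    simp only [oddLeft, leftSeries]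
    split_ifs
    · rw [S.oddMul_tmul_one, S.oddMul_tmul _ hu, hb.twist_eq, mul_smul_comm,
        ← TensorProduct.smul_tmul', LinearMap.smul_apply, TensorProduct.mk_apply]
    · rw [map_zero]
  have hr : S.oddRight (a ⊗ₜ u) (b ⊗ₜ v) (1 ⊗ₜ w) = fun e =>
      (((-1 : ℂ) ^ (j' * i).val * (-1 : ℂ) ^ (i * i').val) •
        TensorProduct.mk ℂ (Odd ι) V (a * b)) (S.rightSeries u v w e) := by
    ext e
    simp only [oddRight, rightSeries]
    split_ifs
    · rw [S.oddMul_tmul_one, S.oddMul_tmul _ hv, ha.twist_eq, mul_smul_comm, ha.mul_comm hb,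
        smul_smul, ← TensorProduct.smul_tmul', LinearMap.smul_apply, TensorProduct.mk_apply]
    · rw [map_zero]
  have hi : S.oddIter (a ⊗ₜ u) (b ⊗ₜ v) (1 ⊗ₜ w) = fun e =>
      ((-1 : ℂ) ^ (j * i').val • TensorProduct.mk ℂ (Odd ι) V (a * b)) (S.iterSeries u v w e) := by
    ext e
    simp only [oddIter, iterSeries]
    split_ifs
    · rw [S.oddMul_tmul _ hu, S.oddMul_tmul_one, hb.twist_eq, mul_smul_comm,
        ← TensorProduct.smul_tmul', LinearMap.smul_apply, TensorProduct.mk_apply]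
    · rw [map_zero]
  rw [hl, hr, hi, funext deltaLeft_zero, funext deltaRight_zero, funext deltaIter_zero,
    seriesMul_algebraMap_comp (S.productExists_leftSeries u v w),
    seriesMul_algebraMap_comp (S.productExists_rightSeries u v w),
    seriesMul_algebraMap_comp (S.productExists_iterSeries u v w), ← S.jacobi_series hu hv w]
  ext e
  simp only [Pi.sub_apply, Pi.smul_apply, LinearMap.smul_apply, map_sub, map_smul, smul_smul]
  congr 2
  rw [add_mul, mul_add, mul_add, negOne_pow_val_add, negOne_pow_val_add, negOne_pow_val_add,
    mul_comm j' i]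
  linear_combination (-1 : ℂ) ^ (j * i').val * (-1 : ℂ) ^ (j * j').val
    * ((-1 : ℂ) ^ (i * i').val * (-1 : ℂ) ^ (i * i').val * negOne_pow_val_mul_self (i * j')
      + negOne_pow_val_mul_self (i * i'))

/-- The Jacobi identity for the vertex operator map on `V[φ]`. -/
theorem jacobi_oddMul {p q : ZMod 2} {U W : Odd ι ⊗[ℂ] V} (hU : U ∈ S.oddSign p)
    (hW : W ∈ S.oddSign q) (w : V) :
    seriesMul (deltaLeft (0 : Odd ι)) (S.oddLeft U W (1 ⊗ₜ w))
      - (-1 : ℂ) ^ (p * q).val • seriesMul (deltaRight (0 : Odd ι)) (S.oddRight U W (1 ⊗ₜ w))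
      = seriesMul (deltaIter (0 : Odd ι)) (S.oddIter U W (1 ⊗ₜ w)) := by
  induction hU using AddSubmonoid.closure_induction with
  | zero =>
    have hl : S.oddLeft 0 W (1 ⊗ₜ w) = 0 := by ext; simp [oddLeft]
    have hr : S.oddRight 0 W (1 ⊗ₜ w) = 0 := by ext; simp [oddRight]
    have hi : S.oddIter 0 W (1 ⊗ₜ w) = 0 := by ext; simp [oddIter]
    rw [hl, hr, hi]
    ext e
    simp [seriesMul]
  | add X Y _ _ h h' =>
    have hl : S.oddLeft (X + Y) W (1 ⊗ₜ w) = S.oddLeft X W (1 ⊗ₜ w) + S.oddLeft Y W (1 ⊗ₜ w) := by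
      ext e; simp only [oddLeft, Pi.add_apply]; split_ifs <;> simp
    have hr : S.oddRight (X + Y) W (1 ⊗ₜ w)
        = S.oddRight X W (1 ⊗ₜ w) + S.oddRight Y W (1 ⊗ₜ w) := by
      ext e; simp only [oddRight, Pi.add_apply]; split_ifs <;> simp
    have hi : S.oddIter (X + Y) W (1 ⊗ₜ w) = S.oddIter X W (1 ⊗ₜ w) + S.oddIter Y W (1 ⊗ₜ w) := by
      ext e; simp only [oddIter, Pi.add_apply]; split_ifs <;> simp
    rw [hl, hr, hi, seriesMul_add_right (S.productExists_oddLeft _ _ _)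
      (S.productExists_oddLeft _ _ _), seriesMul_add_right (S.productExists_oddRight _ _ _)
      (S.productExists_oddRight _ _ _), seriesMul_add_right (S.productExists_oddIter _ _ _)
      (S.productExists_oddIter _ _ _), ← h, ← h', smul_add]
    abel
  | mem X hX =>
    obtain ⟨i, j, a, u, rfl, ha, hu, rfl⟩ := hX
    induction hW using AddSubmonoid.closure_induction with
    | zero =>
      have hl : S.oddLeft (a ⊗ₜ u) 0 (1 ⊗ₜ w) = 0 := by ext; simp [oddLeft]
      have hr : S.oddRight (a ⊗ₜ u) 0 (1 ⊗ₜ w) = 0 := by ext; simp [oddRight]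
      have hi : S.oddIter (a ⊗ₜ u) 0 (1 ⊗ₜ w) = 0 := by ext; simp [oddIter]
      rw [hl, hr, hi]
      ext e
      simp [seriesMul]
    | add X Y _ _ h h' =>
      have hl : S.oddLeft (a ⊗ₜ u) (X + Y) (1 ⊗ₜ w)
          = S.oddLeft (a ⊗ₜ u) X (1 ⊗ₜ w) + S.oddLeft (a ⊗ₜ u) Y (1 ⊗ₜ w) := by
        ext e; simp only [oddLeft, Pi.add_apply]; split_ifs <;> simp
      have hr : S.oddRight (a ⊗ₜ u) (X + Y) (1 ⊗ₜ w)
          = S.oddRight (a ⊗ₜ u) X (1 ⊗ₜ w) + S.oddRight (a ⊗ₜ u) Y (1 ⊗ₜ w) := by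
        ext e; simp only [oddRight, Pi.add_apply]; split_ifs <;> simp
      have hi : S.oddIter (a ⊗ₜ u) (X + Y) (1 ⊗ₜ w)
          = S.oddIter (a ⊗ₜ u) X (1 ⊗ₜ w) + S.oddIter (a ⊗ₜ u) Y (1 ⊗ₜ w) := by
        ext e; simp only [oddIter, Pi.add_apply]; split_ifs <;> simp
      rw [hl, hr, hi, seriesMul_add_right (S.productExists_oddLeft _ _ _)
        (S.productExists_oddLeft _ _ _), seriesMul_add_right (S.productExists_oddRight _ _ _)
        (S.productExists_oddRight _ _ _), seriesMul_add_right (S.productExists_oddIter _ _ _)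
        (S.productExists_oddIter _ _ _), ← h, ← h', smul_add]
      abel
    | mem Y hY =>
      obtain ⟨i', j', b, v, rfl, hb, hv, rfl⟩ := hY
      exact S.jacobi_tmul ha hb hu hv w

/-- The product is constant in `x₀`: the only coefficient that could survive is at exponent `-1`,
where the factor `-1 + 1` vanishes. -/
theorem partialZero_oddLeft (U W X : Odd ι ⊗[ℂ] V) : partialZero (S.oddLeft U W X) = 0 := by
  ext ⟨a, b, c⟩
  rw [partialZero_apply, oddLeft]
  by_cases h : a = -1
  · simp [h]
  · rw [if_neg (by dsimp; omega)]; simp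

theorem partialZero_oddRight (U W X : Odd ι ⊗[ℂ] V) : partialZero (S.oddRight U W X) = 0 := by
  ext ⟨a, b, c⟩
  rw [partialZero_apply, oddRight]
  by_cases h : a = -1
  · simp [h]
  · rw [if_neg (by dsimp; omega)]; simp

theorem translate_oddLeft (s : Odd ι) (U W X : Odd ι ⊗[ℂ] V) :
    translate s (S.oddLeft U W X) = S.oddLeft U W X := by
  simp [translate, partialZero_oddLeft]

theorem translate_oddRight (s : Odd ι) (U W X : Odd ι ⊗[ℂ] V) :
    translate s (S.oddRight U W X) = S.oddRight U W X := by
  simp [translate, partialZero_oddRight]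

theorem partialZero_oddIter (U W X : Odd ι ⊗[ℂ] V) :
    partialZero (S.oddIter U W X) = S.oddIter (S.oddL U) W X := by
  ext ⟨a, b, c⟩
  rw [partialZero_apply, oddIter, oddIter]
  simp only [Prod.mk_add_mk, add_zero, oddMul_oddL]
  split_ifs <;> simp

/-- By the `L(-1)`-derivative property `∂/∂x₀` is `L(-1)` on the first vector, so translation by `s`
is `e^(sL(-1))` there. -/
theorem translate_oddIter (s : Odd ι) (U W X : Odd ι ⊗[ℂ] V) :
    translate s (S.oddIter U W X) = S.oddIter
      (U + s • S.oddL U + (1 / 2 : ℂ) • s ^ 2 • S.oddL (S.oddL U)) W X := by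
  ext e
  rw [translate, partialZero_oddIter, partialZero_oddIter]
  simp only [oddIter, Pi.add_apply, Pi.smul_apply]
  split_ifs <;> simp [oddMul_smul]

/-- The Jacobi identity for the vertex operator map on `V[φ]`, translated by `x₀ ↦ x₀ + s`. -/
theorem jacobi_translate {p q : ZMod 2} {U W : Odd ι ⊗[ℂ] V} (hU : U ∈ S.oddSign p)
    (hW : W ∈ S.oddSign q) (w : V) {s : Odd ι} (hs : s ^ 3 = 0) :
    ProductExists (deltaLeft s) (S.oddLeft U W (1 ⊗ₜ w)) ∧
    ProductExists (deltaRight s) (S.oddRight U W (1 ⊗ₜ w)) ∧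
    ProductExists (deltaIter s) (translate s (S.oddIter U W (1 ⊗ₜ w))) ∧
    seriesMul (deltaLeft s) (S.oddLeft U W (1 ⊗ₜ w))
      - (-1 : ℂ) ^ (p * q).val • seriesMul (deltaRight s) (S.oddRight U W (1 ⊗ₜ w))
      = seriesMul (deltaIter s) (translate s (S.oddIter U W (1 ⊗ₜ w))) := by
  have hl : ∀ d, Commute s (deltaLeft (0 : Odd ι) d) := fun d => by
    rw [deltaLeft_zero]; exact (Algebra.commutes _ _).symm
  have hr : ∀ d, Commute s (deltaRight (0 : Odd ι) d) := fun d => by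
    rw [deltaRight_zero]; exact (Algebra.commutes _ _).symm
  have hi : ∀ d, Commute s (deltaIter (0 : Odd ι) d) := fun d => by
    rw [deltaIter_zero]; exact (Algebra.commutes _ _).symm
  have el := S.productExists_oddLeft U W (1 ⊗ₜ w)
  have er := S.productExists_oddRight U W (1 ⊗ₜ w)
  have ei := S.productExists_oddIter U W (1 ⊗ₜ w)
  -- The first two products equal their own translates, so every product becomes the translate of an
  -- unshifted one.
  rw [deltaLeft_eq_translate hs, deltaRight_eq_translate hs, deltaIter_eq_translate hs,
    ← S.translate_oddLeft s, ← S.translate_oddRight s]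
  refine ⟨el.translate hl, er.translate hr, ei.translate hi, ?_⟩
  rw [← translate_seriesMul el hl hs, ← translate_seriesMul er hr hs,
    ← translate_seriesMul ei hi hs, ← S.jacobi_oddMul hU hW w]
  simp only [translate, map_sub, map_smul, smul_sub, smul_add, smul_comm s, smul_comm (s ^ 2)]
  simp only [smul_comm ((-1 : ℂ) ^ (p * q).val)]
  abel

/-- Skew-symmetry of the vertex operator map on `V[φ]`. -/
theorem oddMul_skew {p j : ZMod 2} {U : Odd ι ⊗[ℂ] V} (hU : U ∈ S.oddSign p) {v : V}
    (hv : v ∈ S.sign j) (n : ℤ) :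
    S.oddMul n U (1 ⊗ₜ v) = (-1 : ℂ) ^ (p * j).val • ∑ᶠ q : ℕ, ((q.factorial : ℂ)⁻¹) •
      (S.oddL ^ q) ((-1 : ℂ) ^ (n - q) • S.oddMul (n - q) (1 ⊗ₜ v) U) := by
  induction hU using AddSubmonoid.closure_induction with
  | zero => simp
  | add X Y _ _ h h' =>
    have hfin (X : Odd ι ⊗[ℂ] V) : {q : ℕ | ((q.factorial : ℂ)⁻¹) • (S.oddL ^ q)
        ((-1 : ℂ) ^ (n - q) • S.oddMul (n - q) (1 ⊗ₜ v) X) ≠ 0}.Finite := by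
      obtain ⟨N, hN⟩ := S.exists_oddMul_eq_zero (1 ⊗ₜ v) X
      refine (Set.finite_Iic (n - N).toNat).subset fun q hq => ?_
      by_contra hq'
      rw [Set.mem_Iic] at hq'
      exact hq (by rw [hN _ (by omega)]; simp)
    simp only [map_add, smul_add]
    rw [LinearMap.add_apply, finsum_add_distrib (hfin X) (hfin Y), h, h', smul_add]
  | mem X hX =>
    obtain ⟨i, k, a, u, rfl, ha, hu, rfl⟩ := hX
    -- A `finsum` with infinite support defaults to zero, so finiteness is needed before `a ⊗ ·` can
    -- pass through it.
    have hfin : {q : ℕ | ((q.factorial : ℂ)⁻¹) • (S.L (-1) ^ q)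
        ((-1 : ℂ) ^ (n - q) • S.coeffY (n - q) v u) ≠ 0}.Finite := by
      obtain ⟨N, hN⟩ := S.exists_coeffY_eq_zero v u
      refine (Set.finite_Iic (n - N).toNat).subset fun q hq => ?_
      by_contra hq'
      rw [Set.mem_Iic] at hq'
      exact hq (by rw [hN _ (by omega)]; simp)
    have hL (q : ℕ) (x : V) : (S.oddL ^ q) (a ⊗ₜ[ℂ] x) = a ⊗ₜ (S.L (-1) ^ q) x := by
      induction q with
      | zero => simp
      | succ q ih => rw [pow_succ', pow_succ', Module.End.mul_apply, ih, oddL_tmul,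
          Module.End.mul_apply]
    have hmap := (TensorProduct.mk ℂ (Odd ι) V a).toAddMonoidHom.map_finsum hfin
    rw [LinearMap.toAddMonoidHom_coe, TensorProduct.mk_apply] at hmap
    rw [S.oddMul_tmul_one, S.coeffY_skew hu hv, TensorProduct.tmul_smul, hmap, smul_finsum,
      smul_finsum]
    refine finsum_congr fun q => ?_
    rw [S.oddMul_tmul _ hv, ha.twist_eq, one_mul, ← TensorProduct.smul_tmul', smul_smul]
    simp only [hL, TensorProduct.mk_apply, map_smul, smul_smul]
    congr 1
    rw [add_mul, negOne_pow_val_add, mul_comm j i]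
    linear_combination -(-1 : ℂ) ^ (k * j).val * (q.factorial : ℂ)⁻¹ * (-1 : ℂ) ^ (n - q)
      * negOne_pow_val_mul_self (i * j)

end VertexOperatorSuperalgebra

/-! ### Exponential of a sum of commuting operators -/

section Exponential

variable {M : Type*} [AddCommGroup M] [Module ℂ M]

theorem add_pow_of_pow_three {R : Type*} [Ring R] {A C : R} (h : Commute A C) (hC : C ^ 3 = 0)
    (m : ℕ) : (A + C) ^ (m + 2) = A ^ (m + 2) + (m + 2 : ℕ) • (A ^ (m + 1) * C)
      + (m + 2).choose 2 • (A ^ m * C ^ 2) := by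
  rw [add_comm A C, h.symm.add_pow, Finset.sum_range_succ', Finset.sum_range_succ',
    Finset.sum_range_succ', Finset.sum_eq_zero fun k _ => ?_]
  · have h1 := (h.pow_left (m + 1)).eq
    have h2 := (h.pow_pow m 2).eq
    rw [nsmul_eq_mul', nsmul_eq_mul', h1, h2]
    simp
    abel
  · rw [pow_eq_zero_of_le (by omega) hC, zero_mul, zero_mul]

theorem formalExp_eq_sum {T : Module.End ℂ (ℤ → M)} {f : ℤ → M} {n : ℤ} {K : ℕ}
    (h : ∀ m ≥ K, (T ^ m) f n = 0) :
    formalExp T f n = ∑ m ∈ Finset.range K, ((m.factorial : ℂ)⁻¹) • (T ^ m) f n := by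
  refine finsum_eq_finsetSum_of_support_subset _ fun m hm => ?_
  by_contra hm'
  rw [Finset.coe_range, Set.mem_Iio, not_lt] at hm'
  exact hm (by dsimp only; rw [h m hm', smul_zero])

/-- This is `e^(A+C) = e^A e^C` with `e^C = 1 + C + C²/2`. The condition `hf` makes each coefficient
a finite sum, with one bound for all the series `C^j f`. -/
theorem formalExp_add {A C : Module.End ℂ (ℤ → M)} (h : Commute A C) (hC : C ^ 3 = 0)
    {f : ℤ → M} (hf : ∀ n, ∃ K : ℕ, ∀ j : ℕ, ∀ m ≥ K, (A ^ m) ((C ^ j) f) n = 0) :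
    ExpExists (A + C) f ∧ formalExp (A + C) f
      = formalExp A (f + C f + (1 / 2 : ℂ) • (C ^ 2) f) := by
  have hpow (m : ℕ) : ((A + C) ^ (m + 2)) f = (A ^ (m + 2)) f + ((m : ℂ) + 2) • (A ^ (m + 1)) (C f)
      + (1 / 2 * (((m : ℂ) + 2) * (m + 1))) • (A ^ m) ((C ^ 2) f) := by
    rw [add_pow_of_pow_three h hC, LinearMap.add_apply, LinearMap.add_apply, LinearMap.smul_apply,
      LinearMap.smul_apply, ← Nat.cast_smul_eq_nsmul ℂ, ← Nat.cast_smul_eq_nsmul ℂ,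
      Nat.cast_choose_two]
    push_cast
    rw [Module.End.mul_apply, Module.End.mul_apply]
    congr 2
    ring
  have hzero (n : ℤ) : ∃ K : ℕ, (∀ m ≥ K, ((A + C) ^ (m + 2)) f n = 0) ∧
      ∀ j : ℕ, ∀ m ≥ K, (A ^ m) ((C ^ j) f) n = 0 := by
    obtain ⟨K, hK⟩ := hf n
    refine ⟨K, fun m hm => ?_, hK⟩
    have h0 := hK 0 (m + 2) (by omega)
    have h1 := hK 1 (m + 1) (by omega)
    have h2 := hK 2 m hm
    rw [pow_zero, Module.End.one_apply] at h0
    rw [pow_one] at h1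
    rw [hpow]
    simp only [Pi.add_apply, Pi.smul_apply, h0, h1, h2, smul_zero, add_zero]
  constructor
  · intro n
    obtain ⟨K, hK, -⟩ := hzero n
    refine (Set.finite_Iio (K + 2)).subset fun m hm => ?_
    by_contra hm'
    rw [Set.mem_Iio, not_lt] at hm'
    refine hm ?_
    rw [← Nat.sub_add_cancel (show 2 ≤ m by omega)]
    exact hK (m - 2) (by omega)
  · ext n
    obtain ⟨K, hK, hA⟩ := hzero n
    have h0 : ∀ m ≥ K, (A ^ m) f n = 0 := hA 0
    have h1 : ∀ m ≥ K, (A ^ m) (C f) n = 0 := by simpa using hA 1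
    have h2 : ∀ m ≥ K, (A ^ m) ((C ^ 2) f) n = 0 := hA 2
    rw [formalExp_eq_sum (K := K + 2), formalExp_eq_sum (K := K + 2)]
    -- The sums containing `C` and `C²` are shortened by one and two terms, to align with the index
    -- shifts in the binomial formula.
    · have e1 : ∑ m ∈ Finset.range (K + 2), ((m.factorial : ℂ)⁻¹) • (A ^ m) (C f) n
          = ∑ m ∈ Finset.range (K + 1), ((m.factorial : ℂ)⁻¹) • (A ^ m) (C f) n := by
        rw [Finset.sum_range_succ, h1 _ (by omega), smul_zero, add_zero]
      have e2 : ∑ m ∈ Finset.range (K + 2), ((m.factorial : ℂ)⁻¹) • (A ^ m) ((C ^ 2) f) n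
          = ∑ m ∈ Finset.range K, ((m.factorial : ℂ)⁻¹) • (A ^ m) ((C ^ 2) f) n := by
        rw [Finset.sum_range_succ, h2 _ (by omega), smul_zero, add_zero, Finset.sum_range_succ,
          h2 _ (by omega), smul_zero, add_zero]
      simp only [map_add, map_smul, Pi.add_apply, Pi.smul_apply, smul_add, Finset.sum_add_distrib,
        smul_comm _ (1 / 2 : ℂ), ← Finset.smul_sum]
      rw [e1, e2, Finset.sum_range_succ', Finset.sum_range_succ',
        Finset.sum_range_succ' _ (K + 1), Finset.sum_range_succ' _ K, Finset.sum_range_succ' _ K]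
      have e3 (m : ℕ) : (((m + 1 + 1).factorial : ℂ)⁻¹) • ((A + C) ^ (m + 1 + 1)) f n
          = (((m + 1 + 1).factorial : ℂ)⁻¹) • (A ^ (m + 1 + 1)) f n
            + (((m + 1).factorial : ℂ)⁻¹) • (A ^ (m + 1)) (C f) n
            + (1 / 2 : ℂ) • ((m.factorial : ℂ)⁻¹) • (A ^ m) ((C ^ 2) f) n := by
        have hm : (m.factorial : ℂ) ≠ 0 := by exact_mod_cast m.factorial_ne_zero
        have hm1 : (m : ℂ) + 1 ≠ 0 := by exact_mod_cast m.succ_ne_zero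
        have hm2 : (m : ℂ) + 2 ≠ 0 := by exact_mod_cast (m + 1).succ_ne_zero
        have hm3 : (m : ℂ) + 1 + 1 ≠ 0 := by exact_mod_cast (m + 1).succ_ne_zero
        rw [hpow, Pi.add_apply, Pi.add_apply, Pi.smul_apply, Pi.smul_apply, smul_add, smul_add,
          smul_smul, smul_smul, smul_smul, Nat.factorial_succ (m + 1), Nat.factorial_succ m]
        push_cast
        congr 2
        · congr 1
          field_simp
          ring
        · field_simp
          ring
      simp only [e3, Finset.sum_add_distrib, ← Finset.smul_sum]
      simp
      abel
    · intro m hm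
      simp only [map_add, map_smul, Pi.add_apply, Pi.smul_apply, h0 m (by omega), h1 m (by omega),
        h2 m (by omega), smul_zero, add_zero]
    · intro m hm
      rw [← Nat.sub_add_cancel (show 2 ≤ m by omega)]
      exact hK (m - 2) (by omega)

end Exponential

/-! ### Jacobi identity and skew-symmetry with odd variables -/

namespace N2SuperconformalVOSA

variable {V : Type*} [AddCommGroup V] [Module ℂ V] (S : N2SuperconformalVOSA V) {ι : Type}

/-- Each `θGᵢ` is even in total, so the signs for `E_θ u` are those for `u`. -/
theorem oddExp_one_tmul_mem {i : ZMod 2} {u : V} (hu : u ∈ S.sign i) (x : Fin 2 → ι → ℂ) :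
    S.oddExp x (1 ⊗ₜ u) ∈ S.oddSign i := by
  have h1 : (1 : ZMod 2) + (1 + i) = i := by
    rw [← add_assoc, show (1 + 1 : ZMod 2) = 0 from rfl, zero_add]
  rw [oddExp_one_tmul]
  refine add_mem (add_mem (add_mem ?_ ?_) ?_) ?_
  · simpa using S.tmul_mem_oddSign hasParity_one hu
  · simpa [h1] using S.tmul_mem_oddSign (hasParity_ι (x 0)) (S.Ghalf_mem 0 hu)
  · simpa [h1] using S.tmul_mem_oddSign (hasParity_ι (x 1)) (S.Ghalf_mem 1 hu)
  · have h := S.tmul_mem_oddSign (hasParity_ι_mul_ι (x 0) (x 1))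
      (S.Ghalf_mem 1 (S.Ghalf_mem 0 hu))
    rwa [h1, zero_add] at h

theorem leftProduct_eq (x y : Fin 2 → ι → ℂ) (u v w : V) :
    S.leftProduct (fun i => ExteriorAlgebra.ι ℂ (x i)) (fun i => ExteriorAlgebra.ι ℂ (y i)) u v w
      = S.oddLeft (S.oddExp x (1 ⊗ₜ u)) (S.oddExp y (1 ⊗ₜ v)) (1 ⊗ₜ w) := by
  ext e
  simp only [leftProduct, VertexOperatorSuperalgebra.oddLeft, oddYApply_eq, oddY_eq,
    S.oddMul_apply]

theorem rightProduct_eq (x y : Fin 2 → ι → ℂ) (u v w : V) :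
    S.rightProduct (fun i => ExteriorAlgebra.ι ℂ (x i)) (fun i => ExteriorAlgebra.ι ℂ (y i)) u v w
      = S.oddRight (S.oddExp x (1 ⊗ₜ u)) (S.oddExp y (1 ⊗ₜ v)) (1 ⊗ₜ w) := by
  ext e
  simp only [rightProduct, VertexOperatorSuperalgebra.oddRight, oddYApply_eq, oddY_eq,
    S.oddMul_apply]

/-- The outer `E_η` is distributed over the inner product as an automorphism; `E_η E_(θ-η) =
e^(sL(-1)) E_θ` then acts on `u`, and `e^(sL(-1))` is translation in `x₀`. -/
theorem iterate_eq (x y : Fin 2 → ι → ℂ) {s : Odd ι}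
    (hs : s = ExteriorAlgebra.ι ℂ (x 0) * ExteriorAlgebra.ι ℂ (y 0)
      + ExteriorAlgebra.ι ℂ (x 1) * ExteriorAlgebra.ι ℂ (y 1)) (u v w : V) :
    S.iterate (fun i => ExteriorAlgebra.ι ℂ (x i)) (fun i => ExteriorAlgebra.ι ℂ (y i)) u v w
      = translate s (S.oddIter (S.oddExp x (1 ⊗ₜ u)) (S.oddExp y (1 ⊗ₜ v)) (1 ⊗ₜ w)) := by
  have hxy : ((fun i => ExteriorAlgebra.ι ℂ (x i)) - fun i => ExteriorAlgebra.ι ℂ (y i))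
      = fun i => ExteriorAlgebra.ι ℂ ((x - y) i) := by
    ext i; simp
  rw [S.translate_oddIter, ← oddExp_oddExp_sub S x y hs]
  ext e
  simp only [iterate, VertexOperatorSuperalgebra.oddIter, hxy, oddYApply_eq, oddYExt_eq,
    ← S.oddMul_apply, oddExp_oddMul]

theorem jacobi_oddVariables (x y : Fin 2 → ι → ℂ) {s : Odd ι}
    (hs : s = ExteriorAlgebra.ι ℂ (x 0) * ExteriorAlgebra.ι ℂ (y 0)
      + ExteriorAlgebra.ι ℂ (x 1) * ExteriorAlgebra.ι ℂ (y 1)) {θ η : Fin 2 → Odd ι}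
    (hθ : θ = fun i => ExteriorAlgebra.ι ℂ (x i)) (hη : η = fun i => ExteriorAlgebra.ι ℂ (y i))
    {i j : ZMod 2} {u v : V} (hu : u ∈ S.sign i) (hv : v ∈ S.sign j) (w : V) :
    ProductExists (deltaLeft s) (S.leftProduct θ η u v w) ∧
    ProductExists (deltaRight s) (S.rightProduct θ η u v w) ∧
    ProductExists (deltaIter s) (S.iterate θ η u v w) ∧
    seriesMul (deltaLeft s) (S.leftProduct θ η u v w)
      - (-1 : ℂ) ^ (i * j).val • seriesMul (deltaRight s) (S.rightProduct θ η u v w)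
      = seriesMul (deltaIter s) (S.iterate θ η u v w) := by
  subst hθ hη
  rw [leftProduct_eq, rightProduct_eq, iterate_eq S x y hs]
  exact S.jacobi_translate (S.oddExp_one_tmul_mem hu x) (S.oddExp_one_tmul_mem hv y) w
    (hs ▸ shift_pow_three x y)

theorem oddExp_oddExp_neg (x : Fin 2 → ι → ℂ) (U : Odd ι ⊗[ℂ] V) :
    S.oddExp x (S.oddExp (-x) U) = U := by
  simp only [oddExp, Module.End.mul_apply, Pi.neg_apply]
  rw [one_add_oddG_comm]
  simp only [oddG_neg, LinearMap.add_apply, LinearMap.neg_apply, Module.End.one_apply, map_add,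
    map_neg, oddG_oddG_self]
  abel_nf

/-- Multiplication by `x` followed by `L(-1)`, on series in `x` with coefficients in `V[φ]`. -/
def shiftL : Module.End ℂ (ℤ → Odd ι ⊗[ℂ] V) :=
  LinearMap.pi fun n => S.oddL ∘ₗ LinearMap.proj (n - 1)

/-- The coefficientwise action of `θ₁ G₁(-1/2) + θ₂ G₂(-1/2)` on series in `x`. -/
def seriesG (x : Fin 2 → ι → ℂ) : Module.End ℂ (ℤ → Odd ι ⊗[ℂ] V) :=
  LinearMap.pi fun n => (S.oddG 0 (x 0) + S.oddG 1 (x 1)) ∘ₗ LinearMap.proj n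

theorem exponent_eq (x : Fin 2 → ι → ℂ) :
    S.exponent (fun i => ExteriorAlgebra.ι ℂ (x i)) = S.shiftL + S.seriesG x := by
  ext f n
  simp [exponent, shiftL, seriesG, S.superAct_one_tmul_L, oddG]

theorem shiftL_pow_apply (m : ℕ) (f : ℤ → Odd ι ⊗[ℂ] V) (n : ℤ) :
    (S.shiftL ^ m) f n = (S.oddL ^ m) (f (n - m)) := by
  induction m generalizing n with
  | zero => simp
  | succ m ih =>
    rw [pow_succ', Module.End.mul_apply, pow_succ', Module.End.mul_apply, Nat.cast_succ,
      add_comm, ← sub_sub, ← ih]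
    rfl

theorem seriesG_apply (x : Fin 2 → ι → ℂ) (f : ℤ → Odd ι ⊗[ℂ] V) (n : ℤ) :
    S.seriesG x f n = (S.oddG 0 (x 0) + S.oddG 1 (x 1)) (f n) := rfl

theorem shiftL_seriesG (x : Fin 2 → ι → ℂ) : Commute (S.shiftL (ι := ι)) (S.seriesG x) := by
  ext f n
  simp [shiftL, seriesG, oddG_oddL]

theorem seriesG_sq (x : Fin 2 → ι → ℂ) (f : ℤ → Odd ι ⊗[ℂ] V) (n : ℤ) :
    (S.seriesG x ^ 2) f n = (2 : ℂ) • S.oddG 0 (x 0) (S.oddG 1 (x 1) (f n)) := by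
  rw [sq, Module.End.mul_apply, seriesG_apply, seriesG_apply]
  simp only [LinearMap.add_apply, map_add, oddG_oddG_self, oddG_comm]
  module

theorem seriesG_pow_three (x : Fin 2 → ι → ℂ) : S.seriesG (V := V) x ^ 3 = 0 := by
  ext f n
  rw [pow_succ, Module.End.mul_apply, seriesG_sq, seriesG_apply]
  simp only [LinearMap.add_apply, map_add, oddG_oddG_self, oddG_comm, add_zero,
    smul_zero, LinearMap.zero_apply, Pi.zero_apply]

/-- For commuting `D₁`, `D₂` of square zero, `(D₁ + D₂)²/2 = D₁D₂`, so the exponential series equals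
`(1 + D₁)(1 + D₂)`. -/
theorem add_seriesG (x : Fin 2 → ι → ℂ) (f : ℤ → Odd ι ⊗[ℂ] V) (n : ℤ) :
    (f + S.seriesG x f + (1 / 2 : ℂ) • (S.seriesG x ^ 2) f) n = S.oddExp x (f n) := by
  simp only [Pi.add_apply, Pi.smul_apply, seriesG_sq, seriesG_apply, oddExp,
    Module.End.mul_apply, LinearMap.add_apply, Module.End.one_apply, map_add]
  module

theorem skew_oddVariables (x : Fin 2 → ι → ℂ) {θ : Fin 2 → Odd ι}
    (hθ : θ = fun i => ExteriorAlgebra.ι ℂ (x i)) {i j : ZMod 2} {u v : V}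
    (hu : u ∈ S.sign i) (hv : v ∈ S.sign j) :
    ExpExists (S.exponent θ) (fun n => (-1 : ℂ) ^ n • S.oddYApply (-θ) v u n) ∧
    S.oddYApply θ u v = (-1 : ℂ) ^ (i * j).val •
      formalExp (S.exponent θ) (fun n => (-1 : ℂ) ^ n • S.oddYApply (-θ) v u n) := by
  subst hθ
  have hneg : (-fun i => ExteriorAlgebra.ι ℂ (x i)) = fun i => ExteriorAlgebra.ι ℂ ((-x) i) := by
    ext i; simp
  simp only [hneg, oddYApply_eq, exponent_eq]
  set f : ℤ → Odd ι ⊗[ℂ] V :=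
    fun n => (-1 : ℂ) ^ n • S.oddMul n (S.oddExp (-x) (1 ⊗ₜ v)) (1 ⊗ₜ u) with hf
  obtain ⟨N, hN⟩ := S.exists_oddMul_eq_zero (S.oddExp (-x) (1 ⊗ₜ v)) (1 ⊗ₜ u)
  have hfN : ∀ n < N, f n = 0 := fun n hn => by rw [hf]; dsimp only; rw [hN n hn, smul_zero]
  have hG (k : ℕ) : ∀ n < N, (S.seriesG x ^ k) f n = 0 := by
    induction k with
    | zero => exact hfN
    | succ k ih =>
      intro n hn
      rw [pow_succ', Module.End.mul_apply, seriesG_apply, ih n hn, map_zero]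
  obtain ⟨hex, hexp⟩ := formalExp_add (f := f) (S.shiftL_seriesG x) (S.seriesG_pow_three x)
    -- From this power on, the coefficient of `x^n` draws on exponents `n - m < N`, where the series
    -- vanishes.
    fun n => ⟨(n - N).toNat + 1, fun k m hm => by
      rw [shiftL_pow_apply, hG k _ (by omega), map_zero]⟩
  refine ⟨hex, funext fun n => ?_⟩
  rw [hexp, oddYApply_eq, Pi.smul_apply, S.oddMul_skew (S.oddExp_one_tmul_mem hu x) hv]
  congr 1
  refine finsum_congr fun q => ?_
  rw [shiftL_pow_apply, add_seriesG, hf]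
  dsimp only
  -- As an automorphism, `E_θ` cancels the `E_(-θ)` on `v` and puts `E_θ` on `u`.
  rw [map_smul (S.oddExp x), oddExp_oddMul, oddExp_oddExp_neg]

end N2SuperconformalVOSA

/-! ### Vacuum, creation and derivative properties -/

namespace N2SuperconformalVOSA

variable {V : Type*} [AddCommGroup V] [Module ℂ V] (S : N2SuperconformalVOSA V) {ι : Type}

theorem coeffY_vacuum (n : ℤ) : S.coeffY n S.vac = if n = 0 then 1 else 0 := S.vacuum n

theorem oddY_apply (θ : Fin 2 → Odd ι) (n : ℤ) (u : V) : S.oddY θ n u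
    = 1 ⊗ₜ S.coeffY n u + θ 0 ⊗ₜ S.coeffY n (S.Ghalf 0 u) + θ 1 ⊗ₜ S.coeffY n (S.Ghalf 1 u)
      + (θ 0 * θ 1) ⊗ₜ S.coeffY n (S.Ghalf 1 (S.Ghalf 0 u)) := rfl

theorem oddYApply_apply (θ : Fin 2 → Odd ι) (n : ℤ) (u v : V) : S.oddYApply θ u v n
    = 1 ⊗ₜ S.coeffY n u v + θ 0 ⊗ₜ S.coeffY n (S.Ghalf 0 u) v
      + θ 1 ⊗ₜ S.coeffY n (S.Ghalf 1 u) v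
      + (θ 0 * θ 1) ⊗ₜ S.coeffY n (S.Ghalf 1 (S.Ghalf 0 u)) v := by
  simp only [oddYApply, oddY_apply, map_add, LinearMap.add_apply, S.superAct_tmul_one]

theorem oddY_vac (θ : Fin 2 → Odd ι) (n : ℤ) :
    S.oddY θ n S.vac = if n = 0 then 1 ⊗ₜ[ℂ] (1 : Module.End ℂ V) else 0 := by
  rw [oddY_apply, Ghalf_vac, Ghalf_vac, coeffY_vacuum]
  split_ifs <;> simp

theorem oddYApply_vac_of_neg (θ : Fin 2 → Odd ι) (v : V) {n : ℤ} (hn : n < 0) :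
    S.oddYApply θ v S.vac n = 0 := by
  simp only [oddYApply_apply, S.coeffY_vac_of_neg _ hn, TensorProduct.tmul_zero, add_zero]

theorem evalOddZero_oddYApply_vac (v : V) :
    evalOddZero V (S.oddYApply (oddVar : Fin 2 → Odd (Fin 2)) v S.vac 0) = v := by
  have h (i : Fin 2) : ExteriorAlgebra.algebraMapInv (R := ℂ) (oddVar i) = 0 := by
    simp [ExteriorAlgebra.algebraMapInv, oddVar]
  have h0 : S.coeffY 0 v S.vac = v := S.creation_zero v
  rw [oddYApply_apply]
  simp [evalOddZero, h, h0]

theorem oddY_L (θ : Fin 2 → Odd ι) (v : V) (n : ℤ) :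
    S.oddY θ n (S.L (-1) v) = dx (fun n => S.oddY θ n v) n := by
  simp only [dx, oddY_apply, ← L_Ghalf, S.coeffY_L, TensorProduct.tmul_smul, smul_add]

theorem oddDeriv_tmul (i : Fin 2) (a : Odd (Fin 2)) (A : Module.End ℂ V) :
    oddDeriv i (Module.End ℂ V) (a ⊗ₜ A) = CliffordAlgebra.contractLeft
      (Q := (0 : QuadraticForm ℂ (Fin 2 → ℂ))) (LinearMap.proj i) a ⊗ₜ A := rfl

theorem contractLeft_proj_one (i : Fin 2) : CliffordAlgebra.contractLeft
    (Q := (0 : QuadraticForm ℂ (Fin 2 → ℂ))) (LinearMap.proj i) (1 : Odd (Fin 2)) = 0 :=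
  CliffordAlgebra.contractLeft_one _ _

theorem contractLeft_oddVar (i j : Fin 2) : CliffordAlgebra.contractLeft
    (Q := (0 : QuadraticForm ℂ (Fin 2 → ℂ))) (LinearMap.proj i) (oddVar j)
      = if i = j then 1 else 0 := by
  refine (CliffordAlgebra.contractLeft_ι _ _ _).trans ?_
  rw [LinearMap.proj_apply, Pi.single_apply]
  split_ifs
  · exact map_one _
  · exact map_zero _

theorem contractLeft_oddVar_mul (i j : Fin 2) (a : Odd (Fin 2)) : CliffordAlgebra.contractLeft
    (Q := (0 : QuadraticForm ℂ (Fin 2 → ℂ))) (LinearMap.proj i) (oddVar j * a)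
      = (if i = j then a else 0) - oddVar j * CliffordAlgebra.contractLeft
    (Q := (0 : QuadraticForm ℂ (Fin 2 → ℂ))) (LinearMap.proj i) a := by
  refine (CliffordAlgebra.contractLeft_ι_mul _ _ _).trans ?_
  rw [LinearMap.proj_apply, Pi.single_apply, ite_smul, one_smul, zero_smul]
  rfl

/-- Terms of `Y(Gᵢ(-1/2)v, (x, φ))` without `φᵢ` come from the left derivative removing `φᵢ`; in
those with `φᵢ`, the relation `Gᵢ(-1/2)² = L(-1)` produces `∂/∂x`. For `i = 1` the signs come from
anticommuting both the variables and the operators. -/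
theorem oddY_Ghalf (v : V) (i : Fin 2) (n : ℤ) :
    S.oddY (oddVar : Fin 2 → Odd (Fin 2)) n (S.Ghalf i v)
      = oddDeriv i (Module.End ℂ V) (S.oddY oddVar n v)
        + (oddVar i : Odd (Fin 2)) • dx (fun n => S.oddY oddVar n v) n := by
  have hsq (i : Fin 2) : (oddVar i : Odd (Fin 2)) * oddVar i = 0 := ExteriorAlgebra.ι_sq_zero _
  have hsw : (oddVar 1 : Odd (Fin 2)) * oddVar 0 = -(oddVar 0 * oddVar 1) := ι_mul_ι_swap _ _
  have h0 : (oddVar 0 : Odd (Fin 2)) * (oddVar 0 * oddVar 1) = 0 := by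
    rw [← mul_assoc, hsq, zero_mul]
  have h1 : (oddVar 1 : Odd (Fin 2)) * (oddVar 0 * oddVar 1) = 0 := by
    rw [← mul_assoc, hsw, neg_mul, mul_assoc, hsq, mul_zero, neg_zero]
  simp only [dx, oddY_apply, map_add, oddDeriv_tmul, contractLeft_proj_one, contractLeft_oddVar,
    contractLeft_oddVar_mul, smul_comm _ ((n : ℂ) + 1), smul_add, TensorProduct.smul_tmul',
    smul_eq_mul, mul_one]
  fin_cases i
  · simp only [Fin.zero_eta, Ghalf_Ghalf, hsq, h0, S.coeffY_L, ← L_Ghalf]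
    simp [TensorProduct.tmul_smul, ← TensorProduct.smul_tmul']
    abel
  · simp only [Fin.mk_one, Ghalf_Ghalf, Ghalf_one_zero, hsq, h1, hsw, S.coeffY_L, ← L_Ghalf,
      map_neg]
    simp [TensorProduct.tmul_smul, TensorProduct.tmul_neg, TensorProduct.neg_tmul]
    abel

end N2SuperconformalVOSA

end N2VOSA

end

theorem proposition1p2 {V : Type*} [AddCommGroup V] [Module ℂ V]
    (S : N2VOSA.N2SuperconformalVOSA V)
    -- `φ₁, φ₂`: the odd variables of `ℂ[φ₁, φ₂]`
    (φ : Fin 2 → N2VOSA.Odd (Fin 2)) (hφ : φ = N2VOSA.oddVar)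
    -- `Φ₁, Φ₂, Ψ₁, Ψ₂`: the odd variables of `ℂ[φ₁, φ₂, ψ₁, ψ₂]`
    (Φ Ψ : Fin 2 → N2VOSA.Odd (Fin 2 ⊕ Fin 2))
    (hΦ : Φ = fun i => N2VOSA.oddVar (Sum.inl i)) (hΨ : Ψ = fun i => N2VOSA.oddVar (Sum.inr i)) :
    -- vacuum property
    (∀ n : ℤ, S.oddY φ n S.vac = if n = 0 then 1 ⊗ₜ[ℂ] (1 : Module.End ℂ V) else 0) ∧
    -- creation property
    (∀ v : V, (∀ n < 0, S.oddYApply φ v S.vac n = 0) ∧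
      N2VOSA.evalOddZero V (S.oddYApply φ v S.vac 0) = v) ∧
    -- Jacobi identity, applied to an arbitrary vector `w`
    (∀ (i j : ZMod 2) (u v : V), u ∈ S.sign i → v ∈ S.sign j → ∀ w : V,
      N2VOSA.ProductExists (N2VOSA.deltaLeft (Φ 0 * Ψ 0 + Φ 1 * Ψ 1))
        (S.leftProduct Φ Ψ u v w) ∧
      N2VOSA.ProductExists (N2VOSA.deltaRight (Φ 0 * Ψ 0 + Φ 1 * Ψ 1))
        (S.rightProduct Φ Ψ u v w) ∧
      N2VOSA.ProductExists (N2VOSA.deltaIter (Φ 0 * Ψ 0 + Φ 1 * Ψ 1))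
        (S.iterate Φ Ψ u v w) ∧
      N2VOSA.seriesMul (N2VOSA.deltaLeft (Φ 0 * Ψ 0 + Φ 1 * Ψ 1)) (S.leftProduct Φ Ψ u v w)
        - (-1 : ℂ) ^ (i * j).val •
          N2VOSA.seriesMul (N2VOSA.deltaRight (Φ 0 * Ψ 0 + Φ 1 * Ψ 1))
            (S.rightProduct Φ Ψ u v w)
        = N2VOSA.seriesMul (N2VOSA.deltaIter (Φ 0 * Ψ 0 + Φ 1 * Ψ 1))
            (S.iterate Φ Ψ u v w)) ∧
    -- `G_i(-1/2)`-derivative property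
    (∀ (v : V) (i : Fin 2) (n : ℤ), S.oddY φ n (S.Ghalf i v)
      = N2VOSA.oddDeriv i (Module.End ℂ V) (S.oddY φ n v)
        + φ i • N2VOSA.dx (fun n => S.oddY φ n v) n) ∧
    -- `L(-1)`-derivative property
    (∀ (v : V) (n : ℤ), S.oddY φ n (S.L (-1) v) = N2VOSA.dx (fun n => S.oddY φ n v) n) ∧
    -- skew-symmetry
    (∀ (i j : ZMod 2) (u v : V), u ∈ S.sign i → v ∈ S.sign j →
      N2VOSA.ExpExists (S.exponent φ) (fun n => (-1 : ℂ) ^ n • S.oddYApply (-φ) v u n) ∧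
      S.oddYApply φ u v = (-1 : ℂ) ^ (i * j).val •
        N2VOSA.formalExp (S.exponent φ) (fun n => (-1 : ℂ) ^ n • S.oddYApply (-φ) v u n)) := by
  have hΦ' : Φ = fun i => ExteriorAlgebra.ι ℂ (Pi.single (Sum.inl i) 1) := hΦ
  have hΨ' : Ψ = fun i => ExteriorAlgebra.ι ℂ (Pi.single (Sum.inr i) 1) := hΨ
  have hφ' : φ = fun i => ExteriorAlgebra.ι ℂ (Pi.single i 1) := hφ
  refine ⟨S.oddY_vac φ, fun v => ⟨fun n => S.oddYApply_vac_of_neg φ v, ?_⟩, ?_, ?_,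
    fun v n => S.oddY_L φ v n, ?_⟩
  · subst hφ
    exact S.evalOddZero_oddYApply_vac v
  · intro i j u v hu hv w
    exact S.jacobi_oddVariables (fun i => Pi.single (Sum.inl i) 1)
      (fun i => Pi.single (Sum.inr i) 1) (by rw [hΦ', hΨ']) hΦ' hΨ' hu hv w
  · intro v i n
    subst hφ
    exact S.oddY_Ghalf v i n
  · intro i j u v hu hv
    exact S.skew_oddVariables (fun i => Pi.single i 1) hφ' hu hv
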